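/- **Setting.** There are $K\ge 1$ queries and $J\ge 1$ judges. A call of judge $j$ on query $k$ costs $c_j>0$ and returns a score in $[0,R]$ with mean $s_k$ and variance $\sigma_{k,j}^2>0$. All scores are independent, and the scores of one pair $(k,j)$ are identically distributed. Fix $p\in[1,\infty]$. An algorithm with score estimate $\hat s\in\mathbb R^K$ that makes $N_{k,j}$ calls to the pair $(k,j)$ is $(B,\delta,\ell_p)$-budget efficient at $(s,\sigma,c)$ with error rate $\varepsilon_p>0$ if $\mathbb P(\|\hat s-s\|_p\le\varepsilon_p)\ge 1-\delta$ and $\sum_j c_j\sum_k N_{k,j}\le B$ almost surely. Put $$\mathcal A_p^*(\sigma,c)=\min_{\omega\ge 0,\ \sum_{k,j}\omega_{k,j}=1}\Big(\sum_{k}\Big(\sum_j\frac{\omega_{k,j}}{c_j\sigma_{k,j}^2}\Big)^{-p/2}\Big)^{2/p}$$ (for $p=\infty$ the objective is $\max_k(\sum_j\omega_{k,j}/(c_j\sigma_{k,j}^2))^{-1}$). **Algorithm Est-IVWE** (inputs $B$, $c$, an integer $N_0\ge 2$, and $\tau>0$). *Phase I:* call every pair $(k,j)$ exactly $N_0$ times,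 and from the scores $s_{k,j}^{(1)},\dots,s_{k,j}^{(N_0)}$ compute $\hat\sigma_{k,j}^2=\frac{1}{2N_0(N_0-1)}\sum_{n\ne n'}(s_{k,j}^{(n)}-s_{k,j}^{(n')})^2$ and $\bar\sigma_{k,j}=\tau+\hat\sigma_{k,j}$. *Phase II:* let $B'=B-N_0K\sum_jc_j$, let $\hat\jmath(k)\in\arg\min_j c_j\bar\sigma_{k,j}^2$ (ties broken by any fixed measurable rule), and put $$\hat\omega_{k,j}=\mathbf 1[j=\hat\jmath(k)]\,\frac{(c_{\hat\jmath(k)}\bar\sigma_{k,\hat\jmath(k)}^2)^{p/(p+2)}}{\sum_{k'}(c_{\hat\jmath(k')}\bar\sigma_{k',\hat\jmath(k')}^2)^{p/(p+2)}},\qquad \hat N_{k,j}=\Big\lfloor \frac{B'\hat\omega_{k,j}}{c_j}\Big\rfloor ,$$ with $p/(p+2)=1$ for $p=\infty$. Call each pair $(k,j)$ another $\hat N_{k,j}$ times, let $\hat s_{k,j}$ be the mean of these new scores ($0$ if there are none), and return $\hat s_k=\big(\sum_j\hat N_{k,j}/\bar\sigma_{k,j}^2\big)^{-1}\sum_j\hat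 N_{k,j}\hat s_{k,j}/\bar\sigma_{k,j}^2$. **Theorem 4.1 (Error rates of Est-IVWE).** Let $p\in[1,\infty]$. For all $K,J\ge1$, $c\in\mathbb R_{>0}^J$ and $\sigma\in\mathbb R_{>0}^{K\times J}$ there is a constant $C>0$, depending only on $p,K,J,c,\sigma$, such that the following holds for all $R>0$, $\delta\in(0,1)$, $B>0$, all $s\in\mathbb R^K$, and all score distributions as above. Let $L=\log\frac{4KJ}{\delta}$ and $$N_0=\begin{cases}\big\lceil(2B)^{1/3}(R^2L)^{2/3}\big\rceil, & p\ge2,\\[2pt] \Big\lceil 2^{\frac{p}{2p+2}}R^{\frac{3p+2}{2p+2}}L^{\frac{3p+2}{4p+4}}B^{\frac{p+2}{4p+4}}\Big\rceil, & 1\le p<2,\end{cases}\qquad \tau=R\sqrt{\frac{2L}{N_0-1}},$$ and suppose that $N_0\ge2$ and $B\ge 2N_0K\sum_jc_j$. Then Est-IVWE with these $N_0$ and $\tau$ is $(B,\delta,\ell_p)$-budget efficient at $(s,\sigma,c)$ with error rate $$\varepsilon_p=\sqrt{\frac{2\,\mathcal A_p^*(\sigma,c)\log\frac{4K}{\delta}}{B}}+C\cdot\begin{cases}\dfrac{R^{1/3}\,\mathcal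 A_p^*(\sigma,c)\,L^{2/3}}{B^{2/3}}, & p\ge2,\\[8pt] \dfrac{R^{\frac{p}{2p+2}}\,\mathcal A_p^*(\sigma,c)\,L^{\frac{3p+2}{4p+4}}}{B^{\frac{3p+2}{4p+4}}}, & 1\le p<2.\end{cases}$$ -/

import Mathlib

open MeasureTheory ProbabilityTheory
open scoped ENNReal BigOperators

namespace JudgeBudget

noncomputable section

/-- A table of scores: `x k j n` is the score returned by the `n`-th call (counted from `0`)
of judge `j` on query `k`. -/
abbrev ScoreTable (K J : ℕ) : Type := Fin K → Fin J → ℕ → ℝ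

/-- The random scores of an instance `(s, σ, c)` with score range `[0, R]`: all scores are
independent, those of one pair `(k, j)` are identically distributed, they lie in `[0, R]`, have
mean `s k` (whatever the judge) and variance `(σ k j) ^ 2`. -/
structure IsScoreModel {K J : ℕ} {Ω : Type*} [MeasurableSpace Ω] (μ : Measure Ω)
    (R : ℝ) (s : Fin K → ℝ) (σ : Fin K → Fin J → ℝ)
    (X : Fin K → Fin J → ℕ → Ω → ℝ) : Prop where
  measurable : ∀ k j n, Measurable (X k j n)
  indep : iIndepFun (fun i : Fin K × Fin J × ℕ => X i.1 i.2.1 i.2.2) μ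
  identDistrib : ∀ k j n, IdentDistrib (X k j n) (X k j 0) μ μ
  bounded : ∀ k j n, ∀ᵐ ω ∂μ, X k j n ω ∈ Set.Icc (0 : ℝ) R
  mean : ∀ k j, ∫ ω, X k j 0 ω ∂μ = s k
  var : ∀ k j, variance (X k j 0) μ = σ k j ^ 2

/-- A query algorithm, through the number of calls that it makes to each pair and the estimate that
it returns. Both depend only on the scores that have been observed: two tables that agree on the
calls made on the first one give the same run. -/
structure Algorithm (K J : ℕ) where
  numQueries : ScoreTable K J → Fin K → Fin J → ℕ
  estimate : ScoreTable K J → Fin K → ℝ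
  observed_only : ∀ x y : ScoreTable K J,
    (∀ k j n, n < numQueries x k j → x k j n = y k j n) →
      numQueries y = numQueries x ∧ estimate y = estimate x

/-- `(B, δ, ℓ_p)`-budget efficiency, with error rate `ε`, of an algorithm run on the random scores
`X` whose mean vector is `s`, when a call to judge `j` costs `c j`. -/
def BudgetEfficient {K J : ℕ} (alg : Algorithm K J) (p : ℝ≥0∞) (B δ ε : ℝ)
    (s : Fin K → ℝ) (c : Fin J → ℝ)
    {Ω : Type*} [MeasurableSpace Ω] (μ : Measure Ω) (X : Fin K → Fin J → ℕ → Ω → ℝ) : Prop :=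
  0 < ε ∧
  1 - δ ≤ μ.real {ω | ‖WithLp.toLp p
      (fun k => alg.estimate (fun k j n => X k j n ω) k - s k)‖ ≤ ε} ∧
  ∀ᵐ ω ∂μ, ∑ j, c j * ∑ k, (alg.numQueries (fun k j n => X k j n ω) k j : ℝ) ≤ B

/-- The budget shares `ω k j ≥ 0` with total `1`. -/
def allocSimplex (K J : ℕ) : Set (Fin K → Fin J → ℝ) :=
  {ω | (∀ k j, 0 ≤ ω k j) ∧ ∑ k, ∑ j, ω k j = 1}

/-- The allocation objective
`𝒜_p(ω; σ, c) = (∑ₖ (∑ⱼ ω k j / (c j * σ k j ^ 2)) ^ (-p / 2)) ^ (2 / p)`, read as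
`maxₖ (∑ⱼ ω k j / (c j * σ k j ^ 2))⁻¹` for `p = ∞`. It takes values in `[0, ∞]`: it is `∞` if some
query gets no budget. -/
def allocObjective {K J : ℕ} (p : ℝ≥0∞) (σ : Fin K → Fin J → ℝ) (c : Fin J → ℝ)
    (ω : Fin K → Fin J → ℝ) : ℝ≥0∞ :=
  if p = ∞ then ⨆ k, (∑ j, ENNReal.ofReal (ω k j / (c j * σ k j ^ 2)))⁻¹
  else (∑ k, (∑ j, ENNReal.ofReal (ω k j / (c j * σ k j ^ 2))) ^ (-(p.toReal / 2)))
    ^ (2 / p.toReal)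

/-- The optimal value `𝒜_p^*(σ, c)`, the minimum of the allocation objective over the simplex. -/
def optValue {K J : ℕ} (p : ℝ≥0∞) (σ : Fin K → Fin J → ℝ) (c : Fin J → ℝ) : ℝ :=
  (⨅ ω ∈ allocSimplex K J, allocObjective p σ c ω).toReal

/-- The exponent `p / (p + 2)`, equal to `1` for `p = ∞`. -/
def shareExponent (p : ℝ≥0∞) : ℝ :=
  if p = ∞ then 1 else p.toReal / (p.toReal + 2)

/-- The oracle allocation for the standard deviations `σ`: query `k` is given only to the judge
`j*(k)` minimizing `c j * σ k j ^ 2`, with a budget share proportional to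
`(c j*(k) * σ k j*(k) ^ 2) ^ (p / (p + 2))`. The map `sel` picks a minimizing index of a vector,
that is, it is the tie-breaking rule. -/
def oracleShare {K J : ℕ} (p : ℝ≥0∞) (sel : (Fin J → ℝ) → Fin J)
    (σ : Fin K → Fin J → ℝ) (c : Fin J → ℝ) (k : Fin K) (j : Fin J) : ℝ :=
  let jStar : Fin K → Fin J := fun k => sel (fun j => c j * σ k j ^ 2)
  let w : Fin K → ℝ := fun k => (c (jStar k) * σ k (jStar k) ^ 2) ^ shareExponent p
  if j = jStar k then w k / ∑ k', w k' else 0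

/-- The mean of the first `N` entries of `x`; it is `0` if `N = 0`. -/
def empMean (N : ℕ) (x : ℕ → ℝ) : ℝ := (∑ i ∈ Finset.range N, x i) / N

/-- The empirical variance `(1 / (2 N (N - 1))) ∑_{n ≠ n'} (x n - x n') ^ 2` of the first `N`
entries of `x`. -/
def empVar (N : ℕ) (x : ℕ → ℝ) : ℝ :=
  1 / (2 * (N : ℝ) * ((N : ℝ) - 1)) * ∑ q ∈ (Finset.range N).offDiag, (x q.1 - x q.2) ^ 2

/-- The inverse-variance weighted estimator with allocation `N` and variance proxies `v`, computed
from the first `N k j` entries of each `x k j`. -/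
def ivwe {K J : ℕ} (N : Fin K → Fin J → ℕ) (v : Fin K → Fin J → ℝ) (x : ScoreTable K J)
    (k : Fin K) : ℝ :=
  (∑ j, (N k j : ℝ) / v k j)⁻¹ * ∑ j, (N k j : ℝ) * empMean (N k j) (x k j) / v k j

/-- The optimistic estimate `τ + σ̂ k j` of the standard deviation, from the first `N₀` scores. -/
def optimisticStd {K J : ℕ} (N₀ : ℕ) (τ : ℝ) (x : ScoreTable K J) (k : Fin K) (j : Fin J) : ℝ :=
  τ + √(empVar N₀ (x k j))

/-- Phase II call numbers: the remaining budget `B - N₀ K ∑ c j` is divided according to the oracle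
allocation for the optimistic estimates, and the call numbers are rounded down. -/
def phaseTwoCount {K J : ℕ} (p : ℝ≥0∞) (sel : (Fin J → ℝ) → Fin J) (B : ℝ) (c : Fin J → ℝ)
    (N₀ : ℕ) (τ : ℝ) (x : ScoreTable K J) (k : Fin K) (j : Fin J) : ℕ :=
  ⌊(B - N₀ * (K * ∑ j, c j)) * oracleShare p sel (optimisticStd N₀ τ x) c k j / c j⌋₊

/-- Est-IVWE: `N₀` calls to every pair, used only to estimate the variances, then the IVWE on
fresh scores, with the optimistic variance estimates both for the allocation and as proxies. -/
def estIVWE {K J : ℕ} (p : ℝ≥0∞) (sel : (Fin J → ℝ) → Fin J) (B : ℝ) (c : Fin J → ℝ)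
    (N₀ : ℕ) (τ : ℝ) : Algorithm K J where
  numQueries x k j := N₀ + phaseTwoCount p sel B c N₀ τ x k j
  estimate x := ivwe (phaseTwoCount p sel B c N₀ τ x)
    (fun k j => optimisticStd N₀ τ x k j ^ 2) (fun k j n => x k j (N₀ + n))
  observed_only x y h := by
    have hv : optimisticStd N₀ τ y = optimisticStd N₀ τ x := by
      funext k j
      unfold optimisticStd empVar
      congr 3
      refine Finset.sum_congr rfl fun q hq => ?_
      rw [Finset.mem_offDiag, Finset.mem_range, Finset.mem_range] at hq
      rw [h k j q.1 (by omega), h k j q.2 (by omega)]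
    have hc : phaseTwoCount p sel B c N₀ τ y = phaseTwoCount p sel B c N₀ τ x := by
      funext k j
      unfold phaseTwoCount
      rw [hv]
    refine ⟨by rw [hc], ?_⟩
    funext k
    rw [hc, hv]
    unfold ivwe
    congr 1
    refine Finset.sum_congr rfl fun j _ => ?_
    have : empMean (phaseTwoCount p sel B c N₀ τ x k j) (fun n => y k j (N₀ + n))
        = empMean (phaseTwoCount p sel B c N₀ τ x k j) (fun n => x k j (N₀ + n)) := by
      unfold empMean
      congr 1
      refine Finset.sum_congr rfl fun i hi => ?_
      rw [Finset.mem_range] at hi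
      exact (h k j (N₀ + i) (by omega)).symm
    rw [this]

/-- The exploration length `N₀`, rounded up to an integer. -/
def explorationLength (p : ℝ≥0∞) (K J : ℕ) (R δ B : ℝ) : ℕ :=
  if 2 ≤ p then
    ⌈(2 * B) ^ (1 / 3 : ℝ) * (R ^ 2 * Real.log (4 * K * J / δ)) ^ (2 / 3 : ℝ)⌉₊
  else
    ⌈(2 : ℝ) ^ (p.toReal / (2 * p.toReal + 2))
      * R ^ ((3 * p.toReal + 2) / (2 * p.toReal + 2))
      * Real.log (4 * K * J / δ) ^ ((3 * p.toReal + 2) / (4 * p.toReal + 4))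
      * B ^ ((p.toReal + 2) / (4 * p.toReal + 4))⌉₊

/-- The optimistic bias `τ = R √((2 / (N₀ - 1)) log (4 K J / δ))`. -/
def optimisticBias (K J : ℕ) (R δ : ℝ) (N₀ : ℕ) : ℝ :=
  R * √(2 / ((N₀ : ℝ) - 1) * Real.log (4 * K * J / δ))

/-- The quantity inside the `𝒪(·)` of the lower-order term of the error rate; `A` stands for
`𝒜_p^*(σ, c)`. -/
def lowerOrderTerm (p : ℝ≥0∞) (K J : ℕ) (R δ B A : ℝ) : ℝ :=
  if 2 ≤ p then
    R ^ (1 / 3 : ℝ) * A * Real.log (4 * K * J / δ) ^ (2 / 3 : ℝ) / B ^ (2 / 3 : ℝ)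
  else
    R ^ (p.toReal / (2 * p.toReal + 2)) * A
      * Real.log (4 * K * J / δ) ^ ((3 * p.toReal + 2) / (4 * p.toReal + 4))
      / B ^ ((3 * p.toReal + 2) / (4 * p.toReal + 4))

end

end JudgeBudget

/-! Let `d k` be the least cost-weighted variance of query `k`, and let `q = p / (p + 2)`. Giving
each query to its cheapest judge with share proportional to `d k ^ q` produces standard errors whose
`ℓ_p` norm is at most the square root of `(∑ d k ^ q) ^ (1 / q)`, per unit of budget. Hölder's
inequality shows that no allocation beats this value (`oracleValue_le_allocObjective`). Only this
lower bound on the optimum is needed. It remains to show that the algorithm loses a relative error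
`O(θ)` against this oracle.

Exploration estimates each standard deviation within a constant times `τ`, by Bernstein's inequality
for the centred scores and for their squares (`empStd_deviation`). Adding `τ` keeps the estimates
away from zero, so they are correct up to a factor `1 + O(τ)` in both directions. The oracle
allocation is stable under such factors (`cost_mul_var_le_oracleShare`). The exploration scores are
not reused in the final means. Given the chosen judge and number of calls, the fresh scores are
therefore independent of that choice, and Bernstein applies with the true variance
(`fresh_deviation`).

For the rates, put `ρ = R² L / B`. In both ranges of `p`, `N₀` is of order `B ρ ^ a`, and the
lower-order term is `A θ √(L / B)` with `θ = ρ ^ (a - 1/2)`. From `1/2 < a ≤ 2/3` alone, the bias,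
the exploration share, the rounding and the range term of Bernstein are all `O(θ)`
(`exists_rate_bounds`). `exists_mean_error_bound` combines these losses into the error of one query,
and the triangle inequality in `ℓ_p` assembles the queries. -/

namespace JudgeBudget

/-! ### Bernstein's inequality for bounded independent variables. -/

section Bernstein

variable {Ω : Type*} [MeasurableSpace Ω] {μ : Measure Ω} [IsProbabilityMeasure μ]

/-- The cubic Taylor remainder is absorbed by the expansion `1 / (1 - |x|) ≥ 1 + |x|`. A quadratic
bound is wanted so that its expectation involves only the mean, the variance and the supremum. -/
lemma exp_le_one_add_add_sq_div {x : ℝ} (hx : |x| < 1) :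
    Real.exp x ≤ 1 + x + x ^ 2 / (2 * (1 - |x|)) := by
  have h := (abs_le.1 (Real.exp_bound hx.le (n := 3) (by norm_num))).2
  norm_num [Finset.sum_range_succ, Nat.factorial] at h
  have hx0 := abs_nonneg x
  have h1 : x ^ 2 / 2 + |x| ^ 3 * (2 / 9) ≤ x ^ 2 / (2 * (1 - |x|)) := by
    rw [le_div_iff₀ (by linarith), ← sq_abs x]
    nlinarith [pow_nonneg hx0 3, pow_nonneg hx0 4]
  linarith

lemma integrable_exp_mul_of_abs_le {Y : Ω → ℝ} (hm : Measurable Y) {M : ℝ}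
    (hb : ∀ᵐ ω ∂μ, |Y ω| ≤ M) (l : ℝ) : Integrable (fun ω => Real.exp (l * Y ω)) μ := by
  refine Integrable.of_bound (by fun_prop) (Real.exp (|l| * M)) ?_
  filter_upwards [hb] with ω hω
  rw [Real.norm_eq_abs, Real.abs_exp, Real.exp_le_exp]
  calc l * Y ω ≤ |l * Y ω| := le_abs_self _
    _ = |l| * |Y ω| := abs_mul _ _
    _ ≤ |l| * M := by gcongr

lemma mgf_le_exp_of_abs_le {Y : Ω → ℝ} (hm : Measurable Y) {M w l : ℝ}
    (hb : ∀ᵐ ω ∂μ, |Y ω| ≤ M) (h0 : ∫ ω, Y ω ∂μ = 0) (hv : ∫ ω, Y ω ^ 2 ∂μ ≤ w)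
    (hl : 0 ≤ l) (hlM : l * M < 1) :
    mgf Y μ l ≤ Real.exp (l ^ 2 * w / (2 * (1 - l * M))) := by
  have hY : Integrable Y μ := Integrable.of_bound hm.aestronglyMeasurable M hb
  have hY2 : Integrable (fun ω => Y ω ^ 2) μ := by
    refine Integrable.of_bound (by fun_prop) (M ^ 2) ?_
    filter_upwards [hb] with ω hω
    rw [Real.norm_eq_abs, abs_pow]
    gcongr
  have hpos : 0 < 2 * (1 - l * M) := by linarith
  have key : mgf Y μ l ≤ ∫ ω, (1 + l * Y ω + l ^ 2 / (2 * (1 - l * M)) * Y ω ^ 2) ∂μ := by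
    refine integral_mono_ae (integrable_exp_mul_of_abs_le hm hb l)
      (((integrable_const _).add (hY.const_mul _)).add (hY2.const_mul _)) ?_
    filter_upwards [hb] with ω hω
    have h1 : |l * Y ω| ≤ l * M := by
      rw [abs_mul, abs_of_nonneg hl]; gcongr
    refine (exp_le_one_add_add_sq_div (h1.trans_lt hlM)).trans ?_
    have : (l * Y ω) ^ 2 / (2 * (1 - |l * Y ω|)) ≤ (l * Y ω) ^ 2 / (2 * (1 - l * M)) := by
      gcongr
    calc _ ≤ 1 + l * Y ω + (l * Y ω) ^ 2 / (2 * (1 - l * M)) := by linarith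
      _ = _ := by ring
  rw [integral_add (by exact (integrable_const _).add (hY.const_mul _)) (hY2.const_mul _),
    integral_add (integrable_const _) (hY.const_mul _), integral_const_mul, integral_const_mul,
    h0] at key
  simp only [integral_const, probReal_univ, smul_eq_mul, mul_one, mul_zero, add_zero] at key
  refine key.trans ?_
  refine le_trans ?_ (Real.add_one_le_exp _)
  have : l ^ 2 / (2 * (1 - l * M)) * ∫ ω, Y ω ^ 2 ∂μ ≤ l ^ 2 / (2 * (1 - l * M)) * w := by
    gcongr
  rw [div_mul_eq_mul_div, div_mul_eq_mul_div] at this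
  rw [div_mul_eq_mul_div]
  linarith

/-- **Bernstein's inequality**, upper tail. -/
lemma bernstein_upper {ι : Type*} {Y : ι → Ω → ℝ} (hm : ∀ i, Measurable (Y i))
    (hind : iIndepFun Y μ) {S : Finset ι} (hS : S.Nonempty) {M w t : ℝ} (hM : 0 < M) (hw : 0 < w)
    (ht : 0 < t) (hb : ∀ i, ∀ᵐ ω ∂μ, |Y i ω| ≤ M) (h0 : ∀ i, ∫ ω, Y i ω ∂μ = 0)
    (hv : ∀ i, ∫ ω, Y i ω ^ 2 ∂μ ≤ w) :
    μ.real {ω | √(2 * (S.card * w) * t) + M * t ≤ ∑ i ∈ S, Y i ω} ≤ Real.exp (-t) := by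
  set v : ℝ := S.card * w with hvdef
  have hv0 : 0 < v := mul_pos (by exact_mod_cast hS.card_pos) hw
  set m : ℝ := √(2 * t / v) with hmdef
  have hm0 : 0 < m := Real.sqrt_pos.2 (by positivity)
  have hm2 : m ^ 2 * v = 2 * t := by
    rw [hmdef, Real.sq_sqrt (by positivity)]; field_simp
  have hu : m * √(2 * v * t) = 2 * t := by
    rw [hmdef, ← Real.sqrt_mul (by positivity)]
    rw [show 2 * t / v * (2 * v * t) = (2 * t) ^ 2 by field_simp]
    exact Real.sqrt_sq (by positivity)
  have hd : 0 < 1 + M * m := by positivity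
  -- This Chernoff parameter makes `1 - l * M = 1 / (1 + M * m)`. With `m ^ 2 * v = 2 * t` the
  -- exponent then collapses to exactly `-t`.
  set l : ℝ := m / (1 + M * m) with hl
  have hl0 : 0 ≤ l := by positivity
  have hlM : 1 - l * M = 1 / (1 + M * m) := by rw [hl]; field_simp; ring
  have hlM1 : l * M < 1 := by
    have : 0 < 1 / (1 + M * m) := by positivity
    linarith
  have hint : Integrable (fun ω => Real.exp (l * ∑ i ∈ S, Y i ω)) μ := by
    refine integrable_exp_mul_of_abs_le (μ := μ) (Finset.measurable_sum _ fun i _ => hm i)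
      (M := S.card * M) ?_ l
    have : ∀ᵐ ω ∂μ, ∀ i ∈ S, |Y i ω| ≤ M := (Finset.eventually_all S).2 fun i _ => hb i
    filter_upwards [this] with ω hω
    refine (Finset.abs_sum_le_sum_abs _ _).trans ?_
    simpa using Finset.sum_le_card_nsmul S _ M hω
  have h := measure_ge_le_exp_mul_mgf (μ := μ) (X := ∑ i ∈ S, Y i) (√(2 * v * t) + M * t) hl0
    (by simpa only [Finset.sum_apply] using hint)
  simp only [Finset.sum_apply] at h
  refine h.trans ?_
  rw [hind.mgf_sum hm]
  have hprod : ∏ i ∈ S, mgf (Y i) μ l ≤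
      Real.exp (l ^ 2 * w / (2 * (1 - l * M))) ^ S.card := by
    rw [← Finset.prod_const]
    exact Finset.prod_le_prod (fun i _ => mgf_nonneg) fun i _ =>
      mgf_le_exp_of_abs_le (hm i) (hb i) (h0 i) (hv i) hl0 hlM1
  calc _ ≤ Real.exp (-l * (√(2 * v * t) + M * t)) *
        Real.exp (l ^ 2 * w / (2 * (1 - l * M))) ^ S.card := by gcongr
    _ = Real.exp (-t) := by
      rw [← Real.exp_nat_mul, ← Real.exp_add]
      congr 1
      rw [hlM]
      have e1 : (S.card : ℝ) * (l ^ 2 * w / (2 * (1 / (1 + M * m)))) = t / (1 + M * m) := by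
        have : (S.card : ℝ) * (l ^ 2 * w / (2 * (1 / (1 + M * m))))
            = m ^ 2 * v / (2 * (1 + M * m)) := by
          rw [hl, hvdef]; field_simp
        rw [this, hm2]; field_simp
      have e2 : -l * (√(2 * v * t) + M * t) = -(2 * t + M * m * t) / (1 + M * m) := by
        rw [← hu, hl]; field_simp
      rw [e1, e2]
      field_simp; ring

/-- **Bernstein's inequality**, two-sided. -/
lemma bernstein {ι : Type*} {Y : ι → Ω → ℝ} (hm : ∀ i, Measurable (Y i))
    (hind : iIndepFun Y μ) {S : Finset ι} (hS : S.Nonempty) {M w t : ℝ} (hM : 0 < M) (hw : 0 < w)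
    (ht : 0 < t) (hb : ∀ i, ∀ᵐ ω ∂μ, |Y i ω| ≤ M) (h0 : ∀ i, ∫ ω, Y i ω ∂μ = 0)
    (hv : ∀ i, ∫ ω, Y i ω ^ 2 ∂μ ≤ w) :
    μ.real {ω | √(2 * (S.card * w) * t) + M * t ≤ |∑ i ∈ S, Y i ω|} ≤ 2 * Real.exp (-t) := by
  have h1 := bernstein_upper hm hind hS hM hw ht hb h0 hv
  have h2 := bernstein_upper (Y := fun i ω => -Y i ω) (fun i => (hm i).neg)
    (hind.comp (fun _ => fun x => -x) fun _ => measurable_neg) hS hM hw ht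
    (by simpa using hb) (fun i => by rw [integral_neg, h0, neg_zero]) (by simpa using hv)
  have hsub : {ω | √(2 * (S.card * w) * t) + M * t ≤ |∑ i ∈ S, Y i ω|} ⊆
      {ω | √(2 * (S.card * w) * t) + M * t ≤ ∑ i ∈ S, Y i ω} ∪
      {ω | √(2 * (S.card * w) * t) + M * t ≤ ∑ i ∈ S, -Y i ω} := by
    intro ω hω
    rw [Set.mem_ofPred_eq, le_abs] at hω
    simpa [Finset.sum_neg_distrib] using hω
  calc _ ≤ _ := measureReal_mono hsub
    _ ≤ _ := measureReal_union_le _ _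
    _ ≤ _ := by linarith

end Bernstein

/-! ### Concentration of the empirical standard deviation. -/

section EmpiricalVariance

/-- Pairwise differences ignore a common shift, so any centre `m` is allowed. With the true mean as
centre, the two sums are the ones that Bernstein controls. -/
lemma empVar_eq {N : ℕ} (hN : 2 ≤ N) (x : ℕ → ℝ) (m : ℝ) :
    empVar N x = N / (N - 1) * ((∑ i ∈ Finset.range N, (x i - m) ^ 2) / N
      - ((∑ i ∈ Finset.range N, (x i - m)) / N) ^ 2) := by
  have hN' : (2 : ℝ) ≤ N := by exact_mod_cast hN
  have h1 : ∑ q ∈ (Finset.range N).offDiag, (x q.1 - x q.2) ^ 2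
      = ∑ i ∈ Finset.range N, ∑ j ∈ Finset.range N, (x i - x j) ^ 2 := by
    rw [← Finset.sum_product', ← Finset.diag_union_offDiag,
      Finset.sum_union (Finset.disjoint_diag_offDiag _), Finset.sum_diag]
    simp
  have h2 : ∑ i ∈ Finset.range N, ∑ j ∈ Finset.range N, (x i - x j) ^ 2
      = 2 * N * (∑ i ∈ Finset.range N, (x i - m) ^ 2)
        - 2 * (∑ i ∈ Finset.range N, (x i - m)) ^ 2 := by
    have : ∀ i j, (x i - x j) ^ 2 =
        (x i - m) ^ 2 + (x j - m) ^ 2 - 2 * ((x i - m) * (x j - m)) := fun i j => by ring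
    simp only [this, Finset.sum_sub_distrib, Finset.sum_add_distrib, ← Finset.mul_sum,
      Finset.sum_const, Finset.card_range, nsmul_eq_mul, ← Finset.sum_mul]
    ring
  have : (N : ℝ) - 1 ≠ 0 := by linarith
  unfold empVar
  rw [h1, h2]
  field_simp

/-- A variance error proportional to `σ τ` becomes an error `O(τ)` after the square root, uniformly
in `σ`. When `σ ≤ 16 τ` the lower bound is trivial; otherwise `τ ^ 2` is dominated by `σ τ`. -/
lemma abs_sqrt_sub_le {V σ τ : ℝ} (hσ : 0 < σ) (hτ : 0 < τ)
    (h : |V - σ ^ 2| ≤ 8 * σ * τ + 7 * τ ^ 2) : |√V - σ| ≤ 16 * τ := by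
  obtain ⟨h1, h2⟩ := abs_le.1 h
  rw [abs_le]
  constructor
  · have : σ - 16 * τ ≤ √V := by
      rcases le_total (σ - 16 * τ) 0 with h0 | h0
      · exact h0.trans (Real.sqrt_nonneg _)
      · exact Real.le_sqrt_of_sq_le (by nlinarith)
    linarith
  · have : √V ≤ σ + 8 * τ := by
      rw [Real.sqrt_le_left (by positivity)]
      nlinarith [mul_pos hσ hτ, sq_nonneg τ]
    linarith

lemma abs_empStd_sub_le {R m σ L τ : ℝ} (hR : 0 < R) (hσ : 0 < σ) (hσR : σ ≤ R) {N : ℕ}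
    (hN : 2 ≤ N) (hL : 1 ≤ L) (hτ : τ = R * √(2 / ((N : ℝ) - 1) * L)) {x : ℕ → ℝ}
    (hbd : ∀ n, |x n - m| ≤ R)
    (hA : |∑ i ∈ Finset.range N, (x i - m)| < √(2 * (N * σ ^ 2) * (3 * L)) + R * (3 * L))
    (hB : |∑ i ∈ Finset.range N, ((x i - m) ^ 2 - σ ^ 2)| <
      √(2 * (N * (R ^ 2 * σ ^ 2)) * (3 * L)) + R ^ 2 * (3 * L)) :
    |√(empVar N x) - σ| ≤ 16 * τ := by
  have hN' : (2 : ℝ) ≤ N := by exact_mod_cast hN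
  have hpos : 0 < 2 / ((N : ℝ) - 1) * L := by
    have : (0 : ℝ) < N - 1 := by linarith
    positivity
  have hτ0 : 0 < τ := by rw [hτ]; positivity
  have hτ2 : τ ^ 2 * (N - 1) = 2 * R ^ 2 * L := by
    have : (N : ℝ) - 1 ≠ 0 := by linarith
    rw [hτ, mul_pow, Real.sq_sqrt hpos.le]; field_simp
  -- The constant is a rational upper bound for `√3`.
  have hs : √(2 * (N * (R ^ 2 * σ ^ 2)) * (3 * L)) ≤ N * (7 / 4 * σ * τ) := by
    rw [Real.sqrt_le_left (by positivity)]
    have : 2 * (N * (R ^ 2 * σ ^ 2)) * (3 * L) = 3 * (N * (N - 1)) * σ ^ 2 * τ ^ 2 := by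
      linear_combination (-3 * N * σ ^ 2) * hτ2
    rw [this]
    have : 0 ≤ σ ^ 2 * τ ^ 2 * N := by positivity
    nlinarith
  have hq : R ^ 2 * (3 * L) ≤ N * (3 / 2 * τ ^ 2) := by nlinarith [sq_nonneg τ]
  have hs' : R * √(2 * (N * σ ^ 2) * (3 * L)) = √(2 * (N * (R ^ 2 * σ ^ 2)) * (3 * L)) := by
    rw [← Real.sqrt_sq hR.le, ← Real.sqrt_mul (by positivity), Real.sqrt_sq hR.le]
    congr 1; ring
  set E : ℝ := 7 / 4 * σ * τ + 3 / 2 * τ ^ 2 with hE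
  have hE0 : 0 ≤ E := by positivity
  have hN0 : (0 : ℝ) < N := by linarith
  have hN1 : (0 : ℝ) < N - 1 := by linarith
  rw [Finset.sum_sub_distrib, Finset.sum_const, Finset.card_range, nsmul_eq_mul] at hB
  have hV := empVar_eq hN x m
  set T₁ : ℝ := ∑ i ∈ Finset.range N, (x i - m) with hT₁
  set T₂ : ℝ := ∑ i ∈ Finset.range N, (x i - m) ^ 2 with hT₂
  have hT1R : |T₁| ≤ N * R := by
    refine (Finset.abs_sum_le_sum_abs _ _).trans ?_
    simpa using Finset.sum_le_card_nsmul (Finset.range N) _ R fun i _ => hbd i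
  have ha : |T₂ / N - σ ^ 2| ≤ E := by
    rw [show T₂ / N - σ ^ 2 = (T₂ - N * σ ^ 2) / N by field_simp, abs_div, abs_of_pos hN0,
      div_le_iff₀ hN0, hE]
    linarith
  -- One factor `|T₁|` is bounded by `N * R` and the other by Bernstein. Multiplying the latter by
  -- `R` gives the same radius as for the squares.
  have hb : (T₁ / N) ^ 2 ≤ E := by
    rw [div_pow, div_le_iff₀ (by positivity), ← sq_abs]
    have h3 : R * |T₁| ≤ N * E := by
      have := mul_le_mul_of_nonneg_left hA.le hR.le
      rw [mul_add, hs'] at this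
      rw [hE]; nlinarith
    calc |T₁| ^ 2 = |T₁| * |T₁| := sq _
      _ ≤ (N * R) * |T₁| := by gcongr
      _ = N * (R * |T₁|) := by ring
      _ ≤ N * (N * E) := by gcongr
      _ = E * N ^ 2 := by ring
  have hV' : empVar N x - σ ^ 2 =
      N / (N - 1) * ((T₂ / N - σ ^ 2) - (T₁ / N) ^ 2) + σ ^ 2 / (N - 1) := by
    rw [hV]; field_simp; ring
  have hσN : σ ^ 2 / (N - 1) ≤ τ ^ 2 / 2 := by
    rw [div_le_iff₀ hN1]
    nlinarith [mul_le_mul hσR hσR hσ.le hR.le]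
  have hσN0 : 0 ≤ σ ^ 2 / ((N : ℝ) - 1) := by positivity
  have hr : (N : ℝ) / (N - 1) ≤ 2 := by rw [div_le_iff₀ hN1]; linarith
  have hd : |N / ((N : ℝ) - 1) * ((T₂ / N - σ ^ 2) - (T₁ / N) ^ 2)| ≤ 2 * (2 * E) := by
    rw [abs_mul, abs_of_nonneg (by positivity)]
    have : |(T₂ / N - σ ^ 2) - (T₁ / N) ^ 2| ≤ 2 * E := by
      rw [abs_le] at ha ⊢
      constructor <;> linarith [sq_nonneg (T₁ / N)]
    gcongr
  -- The total is at most `4 * E + τ ^ 2 / 2 = 7 σ τ + 6.5 τ ^ 2`, within the allowance `8 σ τ + 7 τ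
  -- ^ 2`.
  refine abs_sqrt_sub_le hσ hτ0 ?_
  rw [hV']
  refine (abs_add_le _ _).trans ?_
  rw [abs_of_nonneg hσN0]
  nlinarith [mul_pos hσ hτ0]

variable {Ω : Type*} [MeasurableSpace Ω] {μ : Measure Ω} [IsProbabilityMeasure μ]

/-- An i.i.d. sequence in `[0, R]` with mean `m` and variance `v`. -/
structure IsBoundedSample (μ : Measure Ω) (R m v : ℝ) (X : ℕ → Ω → ℝ) : Prop where
  measurable : ∀ n, Measurable (X n)
  indep : iIndepFun X μ
  bounded : ∀ n, ∀ᵐ ω ∂μ, X n ω ∈ Set.Icc (0 : ℝ) R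
  mean : ∀ n, ∫ ω, X n ω ∂μ = m
  var : ∀ n, ∫ ω, (X n ω - m) ^ 2 ∂μ = v

namespace IsBoundedSample

variable {R m v : ℝ} {X : ℕ → Ω → ℝ}

lemma integrable (h : IsBoundedSample μ R m v X) (n : ℕ) : Integrable (X n) μ := by
  refine Integrable.of_bound (h.measurable n).aestronglyMeasurable R ?_
  filter_upwards [h.bounded n] with ω hω
  rw [Real.norm_eq_abs, abs_of_nonneg hω.1]
  exact hω.2

lemma mean_mem (h : IsBoundedSample μ R m v X) : m ∈ Set.Icc 0 R := by
  constructor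
  · rw [← h.mean 0]
    exact integral_nonneg_of_ae ((h.bounded 0).mono fun ω hω => hω.1)
  · rw [← h.mean 0]
    have := integral_mono_ae (h.integrable 0) (integrable_const R)
      ((h.bounded 0).mono fun ω hω => hω.2)
    simpa using this

lemma abs_sub_le (h : IsBoundedSample μ R m v X) (n : ℕ) : ∀ᵐ ω ∂μ, |X n ω - m| ≤ R := by
  filter_upwards [h.bounded n] with ω hω
  have hm := h.mean_mem
  rw [abs_le]
  constructor <;> linarith [hω.1, hω.2, hm.1, hm.2]

lemma integral_sub (h : IsBoundedSample μ R m v X) (n : ℕ) : ∫ ω, (X n ω - m) ∂μ = 0 := by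
  rw [MeasureTheory.integral_sub (h.integrable n) (integrable_const m), h.mean]
  simp

lemma integrable_sub_pow (h : IsBoundedSample μ R m v X) (n a : ℕ) :
    Integrable (fun ω => (X n ω - m) ^ a) μ := by
  have := h.measurable n
  refine Integrable.of_bound (by fun_prop) (R ^ a) ?_
  filter_upwards [h.abs_sub_le n] with ω hω
  rw [Real.norm_eq_abs, abs_pow]
  gcongr

lemma var_le (h : IsBoundedSample μ R m v X) : v ≤ R ^ 2 := by
  rw [← h.var 0]
  have := integral_mono_ae (h.integrable_sub_pow 0 2) (integrable_const (R ^ 2))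
      ((h.abs_sub_le 0).mono fun ω hω => by
        show (X 0 ω - m) ^ 2 ≤ R ^ 2
        rw [← sq_abs]; gcongr)
  simpa using this

/-- Bernstein's inequality for the sum of a bounded sample. -/
lemma sum_deviation (h : IsBoundedSample μ R m v X) (hR : 0 < R) (hv : 0 < v) {N : ℕ}
    (hN : 0 < N) {t : ℝ} (ht : 0 < t) :
    μ.real {ω | √(2 * (N * v) * t) + R * t ≤ |∑ i ∈ Finset.range N, (X i ω - m)|}
      ≤ 2 * Real.exp (-t) := by
  have := bernstein (Y := fun i ω => X i ω - m) (μ := μ) (fun i => (h.measurable i).sub_const m)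
    (h.indep.comp (fun _ x => x - m) fun _ => by fun_prop)
    (S := Finset.range N) (by simpa using hN.ne') hR hv ht h.abs_sub_le h.integral_sub
    (fun i => (h.var i).le)
  simpa using this

/-- Bernstein's inequality for the squared deviations of a bounded sample. -/
lemma sum_sq_deviation (h : IsBoundedSample μ R m v X) (hR : 0 < R) (hv : 0 < v) {N : ℕ}
    (hN : 0 < N) {t : ℝ} (ht : 0 < t) :
    μ.real {ω | √(2 * (N * (R ^ 2 * v)) * t) + R ^ 2 * t ≤
      |∑ i ∈ Finset.range N, ((X i ω - m) ^ 2 - v)|} ≤ 2 * Real.exp (-t) := by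
  have := bernstein (Y := fun i ω => (X i ω - m) ^ 2 - v) (μ := μ) (M := R ^ 2)
    (w := R ^ 2 * v)
    (fun i => by have := h.measurable i; fun_prop)
    (h.indep.comp (fun _ x => (x - m) ^ 2 - v) fun _ => by fun_prop)
    (S := Finset.range N) (by simpa using hN.ne') (by positivity) (by positivity) ht
    (fun i => by
      filter_upwards [h.abs_sub_le i] with ω hω
      have h1 : (X i ω - m) ^ 2 ≤ R ^ 2 := by rw [← sq_abs]; gcongr
      have := h.var_le
      rw [abs_le]
      constructor <;> linarith [sq_nonneg (X i ω - m)])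
    (fun i => by
      rw [MeasureTheory.integral_sub (h.integrable_sub_pow i 2) (integrable_const v), h.var]
      simp)
    (fun i => by
      have e : ∀ ω, ((X i ω - m) ^ 2 - v) ^ 2 =
          (X i ω - m) ^ 4 - 2 * v * (X i ω - m) ^ 2 + v ^ 2 := fun ω => by ring
      simp only [e]
      have i4 := h.integrable_sub_pow i 4
      have i2 := (h.integrable_sub_pow i 2).const_mul (2 * v)
      rw [MeasureTheory.integral_add (by exact i4.sub i2) (integrable_const _),
        MeasureTheory.integral_sub i4 i2, integral_const_mul, h.var]
      -- The fourth moment is at most `R ^ 2 * v`. This factor `v` is what makes the deviation of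
      -- the squares proportional to `σ`.
      have h4 : ∫ ω, (X i ω - m) ^ 4 ∂μ ≤ ∫ ω, R ^ 2 * (X i ω - m) ^ 2 ∂μ := by
        refine integral_mono_ae i4 ((h.integrable_sub_pow i 2).const_mul _) ?_
        filter_upwards [h.abs_sub_le i] with ω hω
        have h1 : (X i ω - m) ^ 2 ≤ R ^ 2 := by rw [← sq_abs]; gcongr
        calc (X i ω - m) ^ 4 = (X i ω - m) ^ 2 * (X i ω - m) ^ 2 := by ring
          _ ≤ _ := by gcongr
      rw [integral_const_mul, h.var] at h4
      simp only [integral_const, probReal_univ, smul_eq_mul, one_mul]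
      nlinarith)
  simpa using this

/-- The empirical standard deviation is within `16 τ` of the standard deviation, where
`τ = R √(2 L / (N - 1))`, up to an event of probability `4 exp (-3 L)`. -/
lemma empStd_deviation {σ : ℝ} (h : IsBoundedSample μ R m (σ ^ 2) X) (hR : 0 < R) (hσ : 0 < σ)
    {N : ℕ} (hN : 2 ≤ N) {L τ : ℝ} (hL : 1 ≤ L) (hτ : τ = R * √(2 / ((N : ℝ) - 1) * L)) :
    μ.real {ω | 16 * τ < |√(empVar N fun n => X n ω) - σ|} ≤ 4 * Real.exp (-(3 * L)) := by
  have h1 := h.sum_deviation hR (by positivity) (N := N) (by omega) (t := 3 * L) (by linarith)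
  have h2 := h.sum_sq_deviation hR (by positivity) (N := N) (by omega) (t := 3 * L) (by linarith)
  have hσR : σ ≤ R := (abs_le_of_sq_le_sq' h.var_le hR.le).2
  refine (ENNReal.toReal_mono (measure_ne_top _ _) (measure_mono_ae ?_)).trans
    ((measureReal_union_le _ _).trans ((add_le_add h1 h2).trans (by linarith)))
  filter_upwards [ae_all_iff.2 h.abs_sub_le] with ω hbd hω
  by_contra hcon
  obtain ⟨hA, hB⟩ := not_or.1 hcon
  exact absurd (abs_empStd_sub_le hR hσ hσR hN hL hτ hbd (not_le.1 hA) (not_le.1 hB))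
    (not_le.2 hω)

end IsBoundedSample

end EmpiricalVariance

/-! ### Fresh scores after a data-dependent choice, and the good event. -/

section GoodEvent

variable {Ω : Type*} [MeasurableSpace Ω] {μ : Measure Ω}
variable {K J : ℕ} {R : ℝ} {s : Fin K → ℝ} {σ : Fin K → Fin J → ℝ}
  {X : Fin K → Fin J → ℕ → Ω → ℝ}

lemma IsScoreModel.sample (h : IsScoreModel μ R s σ X) (k : Fin K) (j : Fin J) (a : ℕ) :
    IsBoundedSample μ R (s k) (σ k j ^ 2) fun n => X k j (a + n) where
  measurable n := h.measurable k j _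
  indep := h.indep.precomp (g := fun n : ℕ => (k, j, a + n)) fun n m hnm => by simpa using hnm
  bounded n := h.bounded k j _
  mean n := by rw [(h.identDistrib k j (a + n)).integral_eq, h.mean]
  var n := by
    have hm : ∫ ω, X k j (a + n) ω ∂μ = s k := by
      rw [(h.identDistrib k j (a + n)).integral_eq, h.mean]
    rw [← h.var k j, ← (h.identDistrib k j (a + n)).variance_eq,
      variance_eq_integral (h.measurable k j _).aemeasurable, hm]

variable [IsProbabilityMeasure μ]

/-- Total probability over the countably many values of `V`: on `V = b` the bad event is `D b`,
which is independent of `V = b`, so the uniform bound survives without a union bound over `b`. -/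
lemma measure_mem_random_index_le {β : Type*} [Countable β] [MeasurableSpace β]
    [MeasurableSingletonClass β] {V : Ω → β} (hV : Measurable V) {D : β → Set Ω} {ε : ℝ≥0∞}
    (hind : ∀ b, μ (V ⁻¹' {b} ∩ D b) = μ (V ⁻¹' {b}) * μ (D b)) (hD : ∀ b, μ (D b) ≤ ε) :
    μ {ω | ω ∈ D (V ω)} ≤ ε := by
  have hsub : {ω | ω ∈ D (V ω)} ⊆ ⋃ b, V ⁻¹' {b} ∩ D b := fun ω hω =>
    Set.mem_iUnion.2 ⟨V ω, rfl, hω⟩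
  have htot : ∑' b, μ (V ⁻¹' {b}) = 1 := by
    rw [← measure_iUnion (fun a b hab => ?_) fun b => hV (measurableSet_singleton b),
      ← Set.preimage_iUnion, Set.iUnion_of_singleton, Set.preimage_univ, measure_univ]
    exact Disjoint.preimage _ (by simpa using hab)
  calc _ ≤ μ (⋃ b, V ⁻¹' {b} ∩ D b) := measure_mono hsub
    _ ≤ ∑' b, μ (V ⁻¹' {b} ∩ D b) := measure_iUnion_le _
    _ ≤ ∑' b, μ (V ⁻¹' {b}) * ε := ENNReal.tsum_le_tsum fun b => by
        rw [hind]; gcongr; exact hD b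
    _ = ε := by rw [ENNReal.tsum_mul_right, htot, one_mul]

lemma measurable_comp_index {α β ι : Type*} [MeasurableSpace α] [MeasurableSpace β]
    [MeasurableSpace ι] [Countable ι] [MeasurableSingletonClass ι] {f : α → ι} (hf : Measurable f)
    {F : ι → α → β} (hF : ∀ i, Measurable (F i)) : Measurable fun x => F (f x) x :=
  (measurable_from_prod_countable_right (f := fun q : ι × α => F q.1 q.2) hF).comp
    (hf.prodMk measurable_id)

/-- The judge chosen for query `k` when the standard deviations are believed to be `v`. -/
def chosenJudge (sel : (Fin J → ℝ) → Fin J) (c : Fin J → ℝ) (v : Fin K → Fin J → ℝ)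
    (k : Fin K) : Fin J := sel fun j => c j * v k j ^ 2

/-- The number of fresh calls to judge `j` on query `k` for believed standard deviations `v` and a
remaining budget `b`. -/
noncomputable def freshCount (p : ℝ≥0∞) (sel : (Fin J → ℝ) → Fin J) (b : ℝ) (c : Fin J → ℝ)
    (v : Fin K → Fin J → ℝ) (k : Fin K) (j : Fin J) : ℕ :=
  ⌊b * oracleShare p sel v c k j / c j⌋₊

lemma measurable_chosenJudge {sel : (Fin J → ℝ) → Fin J} (hsel : Measurable sel) (c : Fin J → ℝ)
    (k : Fin K) : Measurable fun v : Fin K → Fin J → ℝ => chosenJudge sel c v k :=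
  hsel.comp (by fun_prop)

lemma measurable_oracleShare (p : ℝ≥0∞) {sel : (Fin J → ℝ) → Fin J} (hsel : Measurable sel)
    (c : Fin J → ℝ) (k : Fin K) (j : Fin J) :
    Measurable fun v : Fin K → Fin J → ℝ => oracleShare p sel v c k j := by
  have hw : ∀ k : Fin K, Measurable fun v : Fin K → Fin J → ℝ =>
      (c (chosenJudge sel c v k) * v k (chosenJudge sel c v k) ^ 2) ^ shareExponent p := fun k =>
    (measurable_comp_index (measurable_chosenJudge hsel c k)
      (F := fun j (v : Fin K → Fin J → ℝ) => c j * v k j ^ 2) fun j => by fun_prop).pow_const _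
  refine Measurable.ite ?_ ((hw k).div (Finset.measurable_sum _ fun k' _ => hw k'))
    measurable_const
  exact (measurable_chosenJudge hsel c k) (measurableSet_singleton j) |> fun h => by
    convert h using 1
    ext v
    exact eq_comm

lemma measurable_freshCount (p : ℝ≥0∞) {sel : (Fin J → ℝ) → Fin J} (hsel : Measurable sel)
    (b : ℝ) (c : Fin J → ℝ) (k : Fin K) (j : Fin J) :
    Measurable fun v : Fin K → Fin J → ℝ => freshCount p sel b c v k j :=
  Nat.measurable_floor.comp (((measurable_oracleShare p hsel c k j).const_mul b).div_const _)

lemma measurable_optimisticStd (N₀ : ℕ) (τ : ℝ) :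
    Measurable fun x : ScoreTable K J => optimisticStd N₀ τ x := by
  unfold optimisticStd empVar
  fun_prop

lemma optimisticStd_congr {N₀ : ℕ} {τ : ℝ} {x y : ScoreTable K J}
    (h : ∀ k j n, n < N₀ → x k j n = y k j n) : optimisticStd N₀ τ x = optimisticStd N₀ τ y := by
  funext k j
  unfold optimisticStd empVar
  congr 3
  refine Finset.sum_congr rfl fun q hq => ?_
  rw [Finset.mem_offDiag, Finset.mem_range, Finset.mem_range] at hq
  rw [h k j q.1 hq.1, h k j q.2 hq.2.1]

/-- Deviation of a sum of fresh scores whose judge and number are functions of the first `N₀`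
scores of all the pairs. -/
lemma IsScoreModel.fresh_deviation (h : IsScoreModel μ R s σ X) (hR : 0 < R)
    (hσ : ∀ k j, 0 < σ k j) (N₀ : ℕ) (τ : ℝ) (k : Fin K)
    {G : (Fin K → Fin J → ℝ) → Fin J × ℕ} (hG : Measurable G) {t : ℝ} (ht : 0 < t) :
    μ.real {ω | let q := G (optimisticStd N₀ τ fun k j n => X k j n ω)
      0 < q.2 ∧ √(2 * (q.2 * σ k q.1 ^ 2) * t) + R * t ≤
        |∑ i ∈ Finset.range q.2, (X k q.1 (N₀ + i) ω - s k)|} ≤ 2 * Real.exp (-t) := by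
  have hmeas : Measurable fun ω => fun k j n => X k j n ω :=
    measurable_pi_lambda _ fun k => measurable_pi_lambda _ fun j => measurable_pi_lambda _ fun n =>
      h.measurable k j n
  set V : Ω → Fin J × ℕ := fun ω => G (optimisticStd N₀ τ fun k j n => X k j n ω) with hV
  have hVm : Measurable V := hG.comp ((measurable_optimisticStd N₀ τ).comp hmeas)
  set D : Fin J × ℕ → Set Ω := fun q => {ω | 0 < q.2 ∧
    √(2 * (q.2 * σ k q.1 ^ 2) * t) + R * t ≤
      |∑ i ∈ Finset.range q.2, (X k q.1 (N₀ + i) ω - s k)|} with hD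
  have hε : (0 : ℝ) ≤ 2 * Real.exp (-t) := by positivity
  refine ENNReal.toReal_le_of_le_ofReal hε
    (measure_mem_random_index_le (V := V) (D := D) hVm ?_ ?_)
  · rintro ⟨j, n⟩
    -- The choice is a function of the exploration scores `S`, and for a fixed choice the deviation
    -- is a function of the scores in `T`. Both families are finite and disjoint; `ext` pads them by
    -- zero to full tables, which changes none of the entries that are read.
    set S : Finset (Fin K × Fin J × ℕ) := Finset.univ ×ˢ Finset.univ ×ˢ Finset.range N₀ with hS
    set T : Finset (Fin K × Fin J × ℕ) :=
      Finset.univ ×ˢ Finset.univ ×ˢ Finset.Ico N₀ (N₀ + n) with hT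
    have hST : Disjoint S T := by
      rw [Finset.disjoint_left]
      rintro ⟨a, b, i⟩ h1 h2
      simp [hS, hT] at h1 h2
      omega
    have hind := h.indep.indepFun_finset S T hST fun i => h.measurable i.1 i.2.1 i.2.2
    set ext : (U : Finset (Fin K × Fin J × ℕ)) → (U → ℝ) → ScoreTable K J :=
      fun U y k j n => if hu : (k, j, n) ∈ U then y ⟨(k, j, n), hu⟩ else 0 with hext
    have hextm : ∀ U, Measurable (ext U) := by
      intro U
      refine measurable_pi_lambda _ fun k => measurable_pi_lambda _ fun j =>
        measurable_pi_lambda _ fun n => ?_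
      by_cases hu : (k, j, n) ∈ U
      · simp only [hext, hu, dite_true]; exact measurable_pi_apply _
      · simp only [hext, hu, dite_false]; exact measurable_const
    have e1 : V ⁻¹' {(j, n)} = (fun ω (i : S) => X i.1.1 i.1.2.1 i.1.2.2 ω) ⁻¹'
        ((fun y => G (optimisticStd N₀ τ (ext S y))) ⁻¹' {(j, n)}) := by
      ext ω
      have : optimisticStd N₀ τ (ext S fun i : S => X i.1.1 i.1.2.1 i.1.2.2 ω)
          = optimisticStd N₀ τ fun k j n => X k j n ω :=
        optimisticStd_congr fun a b i hi => by
          have : (a, b, i) ∈ S := by simp [hS, hi]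
          simp only [hext, this, dite_true]
      simp only [Set.mem_preimage, this, hV]
    have e2 : D (j, n) = (fun ω (i : T) => X i.1.1 i.1.2.1 i.1.2.2 ω) ⁻¹'
        {y | 0 < n ∧ √(2 * (n * σ k j ^ 2) * t) + R * t ≤
          |∑ i ∈ Finset.range n, (ext T y k j (N₀ + i) - s k)|} := by
      ext ω
      have : ∀ i ∈ Finset.range n, X k j (N₀ + i) ω - s k =
          ext T (fun i : T => X i.1.1 i.1.2.1 i.1.2.2 ω) k j (N₀ + i) - s k := by
        intro i hi
        have : (k, j, N₀ + i) ∈ T := by simpa [hT] using hi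
        simp only [hext, this, dite_true]
      simp only [hD, Set.mem_preimage, Set.mem_ofPred_eq, Finset.sum_congr rfl this]
    rw [e1, e2]
    refine hind.measure_inter_preimage_eq_mul _ _ ?_ ?_
    · exact (hG.comp ((measurable_optimisticStd N₀ τ).comp (hextm S)))
        (measurableSet_singleton _)
    · have hm : ∀ i, Measurable fun y => ext T y k j (N₀ + i) := fun i =>
        (measurable_pi_apply (N₀ + i)).comp ((measurable_pi_apply j).comp
          ((measurable_pi_apply k).comp (hextm T)))
      have hm' : Measurable fun y => |∑ i ∈ Finset.range n, (ext T y k j (N₀ + i) - s k)| :=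
        (Finset.measurable_sum _ fun i _ => (hm i).sub_const _).abs
      exact (MeasurableSet.const _).inter (measurableSet_le measurable_const hm')
  · rintro ⟨j, n⟩
    rcases Nat.eq_zero_or_pos n with rfl | hn
    · simp [hD]
    · rw [← ENNReal.ofReal_toReal (measure_ne_top μ (D (j, n)))]
      refine ENNReal.ofReal_le_ofReal (le_trans ?_ ((h.sample k j N₀).sum_deviation hR
        (pow_pos (hσ k j) 2) hn ht))
      exact measureReal_mono fun ω hω => hω.2

/-- With probability at least `1 - δ`, all the empirical standard deviations of the exploration
phase and all the means of fresh scores are accurate. -/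
lemma IsScoreModel.good_event (h : IsScoreModel μ R s σ X) (hR : 0 < R)
    (hσ : ∀ k j, 0 < σ k j) (hK : 1 ≤ K) (hJ : 1 ≤ J) {N₀ : ℕ} (hN₀ : 2 ≤ N₀) {δ τ : ℝ}
    (hδ : δ ∈ Set.Ioo (0 : ℝ) 1) (hτ : τ = optimisticBias K J R δ N₀)
    {G : Fin K → (Fin K → Fin J → ℝ) → Fin J × ℕ} (hG : ∀ k, Measurable (G k)) :
    1 - δ ≤ μ.real {ω |
      (∀ k j, |√(empVar N₀ fun n => X k j n ω) - σ k j| ≤ 16 * τ) ∧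
      (∀ k, let q := G k (optimisticStd N₀ τ fun k j n => X k j n ω)
        0 < q.2 → |∑ i ∈ Finset.range q.2, (X k q.1 (N₀ + i) ω - s k)| ≤
          √(2 * (q.2 * σ k q.1 ^ 2) * Real.log (4 * K / δ)) + R * Real.log (4 * K / δ)) ∧
      ∀ k j n, X k j n ω ∈ Set.Icc (0 : ℝ) R} := by
  obtain ⟨hδ0, hδ1⟩ := hδ
  have hK' : (1 : ℝ) ≤ K := by exact_mod_cast hK
  have hJ' : (1 : ℝ) ≤ J := by exact_mod_cast hJ
  set L := Real.log (4 * K * J / δ) with hL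
  set l := Real.log (4 * K / δ) with hl
  have hKJ : (1 : ℝ) ≤ K * J := one_le_mul_of_one_le_of_one_le hK' hJ'
  have h4 : 4 ≤ 4 * K * J / δ := by
    rw [le_div_iff₀ hδ0]; nlinarith
  have hL1 : 1 ≤ L := by
    rw [hL, Real.le_log_iff_exp_le (by linarith)]
    linarith [Real.exp_one_lt_d9]
  have hl0 : 0 < l := by
    rw [hl]
    refine Real.log_pos ?_
    rw [lt_div_iff₀ hδ0]; nlinarith
  have heL : Real.exp (-L) = δ / (4 * K * J) := by
    rw [Real.exp_neg, hL, Real.exp_log (by linarith), inv_div]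
  have hel : Real.exp (-l) = δ / (4 * K) := by
    rw [Real.exp_neg, hl, Real.exp_log (by positivity), inv_div]
  -- The level `3 * L` leaves room in the confidence budget: the exploration events cost `δ / 16` in
  -- total, and the fresh means `δ / 2`.
  have he3 : Real.exp (-(3 * L)) ≤ δ / (4 * K * J) / 16 := by
    have h5 : δ / (4 * K * J) ≤ 1 / 4 := by
      rw [div_le_iff₀ (by nlinarith)]; nlinarith
    have h6 : 0 ≤ δ / (4 * K * J) := by positivity
    rw [show -(3 * L) = -L + -L + -L by ring, Real.exp_add, Real.exp_add, heL]
    calc _ ≤ (1 / 4) * (1 / 4) * (δ / (4 * K * J)) := by gcongr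
      _ = _ := by ring
  set E₁ : Fin K → Fin J → Set Ω := fun k j =>
    {ω | 16 * τ < |√(empVar N₀ fun n => X k j n ω) - σ k j|} with hE₁
  set E₂ : Fin K → Set Ω := fun k => {ω |
      let q := G k (optimisticStd N₀ τ fun k j n => X k j n ω)
      0 < q.2 ∧ √(2 * (q.2 * σ k q.1 ^ 2) * l) + R * l ≤
        |∑ i ∈ Finset.range q.2, (X k q.1 (N₀ + i) ω - s k)|} with hE₂
  set E₃ : Set Ω := {ω | ¬ ∀ k j n, X k j n ω ∈ Set.Icc (0 : ℝ) R} with hE₃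
  have hp1 : ∀ k j, μ.real (E₁ k j) ≤ 4 * (δ / (4 * K * J) / 16) := by
    intro k j
    have := (h.sample k j 0).empStd_deviation hR (hσ k j) hN₀ hL1 hτ
    simp only [zero_add] at this
    exact this.trans (by gcongr)
  have hp2 : ∀ k, μ.real (E₂ k) ≤ 2 * (δ / (4 * K)) := fun k =>
    (h.fresh_deviation hR hσ N₀ τ k (hG k) hl0).trans (by rw [hel])
  have hp3 : μ.real E₃ = 0 := by
    have : ∀ᵐ ω ∂μ, ∀ k j n, X k j n ω ∈ Set.Icc (0 : ℝ) R :=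
      ae_all_iff.2 fun k => ae_all_iff.2 fun j => ae_all_iff.2 fun n => h.bounded k j n
    rw [measureReal_def, ae_iff.1 this]; rfl
  set A : Set Ω := {ω |
      (∀ k j, |√(empVar N₀ fun n => X k j n ω) - σ k j| ≤ 16 * τ) ∧
      (∀ k, let q := G k (optimisticStd N₀ τ fun k j n => X k j n ω)
        0 < q.2 → |∑ i ∈ Finset.range q.2, (X k q.1 (N₀ + i) ω - s k)| ≤
          √(2 * (q.2 * σ k q.1 ^ 2) * l) + R * l) ∧
      ∀ k j n, X k j n ω ∈ Set.Icc (0 : ℝ) R} with hA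
  -- Covering the space and using subadditivity avoids any measurability of `A`.
  have hcov : (Set.univ : Set Ω) ⊆ A ∪ ((⋃ k, ⋃ j, E₁ k j) ∪ ((⋃ k, E₂ k) ∪ E₃)) := by
    intro ω _
    by_contra hcon
    simp only [Set.mem_union, Set.mem_iUnion, not_or, not_exists] at hcon
    obtain ⟨h0, h1, h2, h3⟩ := hcon
    refine h0 ⟨fun k j => not_lt.1 (h1 k j), fun k hq => ?_, not_not.1 h3⟩
    by_contra hc
    exact h2 k ⟨hq, (not_le.1 hc).le⟩
  have hs1 : μ.real (⋃ k, ⋃ j, E₁ k j) ≤ δ / 2 := by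
    calc _ ≤ ∑ k, μ.real (⋃ j, E₁ k j) := measureReal_iUnion_fintype_le _
      _ ≤ ∑ k : Fin K, ∑ j : Fin J, 4 * (δ / (4 * K * J) / 16) :=
        Finset.sum_le_sum fun k _ => (measureReal_iUnion_fintype_le _).trans
          (Finset.sum_le_sum fun j _ => hp1 k j)
      _ = δ / 16 := by simp; field_simp
      _ ≤ δ / 2 := by linarith
  have hs2 : μ.real (⋃ k, E₂ k) ≤ δ / 2 := by
    calc _ ≤ ∑ k, μ.real (E₂ k) := measureReal_iUnion_fintype_le _
      _ ≤ ∑ k : Fin K, 2 * (δ / (4 * K)) := Finset.sum_le_sum fun k _ => hp2 k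
      _ = δ / 2 := by simp; field_simp; norm_num
  have := measureReal_mono (μ := μ) hcov
  rw [probReal_univ] at this
  have u1 := measureReal_union_le (μ := μ) A ((⋃ k, ⋃ j, E₁ k j) ∪ ((⋃ k, E₂ k) ∪ E₃))
  have u2 := measureReal_union_le (μ := μ) (⋃ k, ⋃ j, E₁ k j) ((⋃ k, E₂ k) ∪ E₃)
  have u3 := measureReal_union_le (μ := μ) (⋃ k, E₂ k) E₃
  linarith

end GoodEvent

/-! ### The value of the oracle allocation. -/

section Optimum

variable {K J : ℕ}

lemma shareExponent_pos {p : ℝ≥0∞} (hp : 1 ≤ p) : 0 < shareExponent p := by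
  unfold shareExponent
  split_ifs with h
  · exact one_pos
  · have : 0 < p.toReal := ENNReal.toReal_pos (by rintro rfl; simp at hp) h
    positivity

lemma shareExponent_le_one (p : ℝ≥0∞) : shareExponent p ≤ 1 := by
  unfold shareExponent
  split_ifs with h
  · exact le_rfl
  · have : 0 ≤ p.toReal := ENNReal.toReal_nonneg
    rw [div_le_one (by positivity)]
    linarith

/-- Hölder with exponents `(P + 2) / 2` and `(P + 2) / P`, applied to `d = (d / w) * w` raised to
the power `P / (P + 2)`; the second factor disappears because the shares sum to one. -/
lemma rpow_sum_share_le {P : ℝ} (hP : 0 < P) {ι : Type*} (S : Finset ι) {w d : ι → ℝ}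
    (hw : ∀ k, 0 < w k) (hd : ∀ k, 0 < d k) (hsum : ∑ k ∈ S, w k = 1) :
    (∑ k ∈ S, d k ^ (P / (P + 2))) ^ ((P + 2) / P) ≤
      (∑ k ∈ S, (w k / d k) ^ (-(P / 2))) ^ (2 / P) := by
  have hconj : ((P + 2) / 2).HolderConjugate ((P + 2) / P) := by
    rw [Real.holderConjugate_iff]
    constructor
    · linarith
    · field_simp; ring
  have h := Real.inner_le_Lp_mul_Lq_of_nonneg S hconj
    (f := fun k => (d k / w k) ^ (P / (P + 2))) (g := fun k => w k ^ (P / (P + 2)))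
    (fun k _ => by have := hw k; have := hd k; positivity)
    (fun k _ => by have := hw k; positivity)
  have e1 : ∀ k, (d k / w k) ^ (P / (P + 2)) * w k ^ (P / (P + 2)) = d k ^ (P / (P + 2)) := by
    intro k
    have := hw k; have := hd k
    rw [← Real.mul_rpow (by positivity) (by positivity)]
    congr 1; field_simp
  have e2 : ∀ k, ((d k / w k) ^ (P / (P + 2))) ^ ((P + 2) / 2) = (w k / d k) ^ (-(P / 2)) := by
    intro k
    have := hw k; have := hd k
    rw [← Real.rpow_mul (by positivity), Real.rpow_neg (by positivity),
      ← Real.inv_rpow (by positivity), inv_div]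
    congr 1; field_simp
  have e3 : ∀ k, (w k ^ (P / (P + 2))) ^ ((P + 2) / P) = w k := by
    intro k
    rw [← Real.rpow_mul (hw k).le, show P / (P + 2) * ((P + 2) / P) = 1 by field_simp,
      Real.rpow_one]
  simp only [e1, e2, e3, hsum, Real.one_rpow, mul_one] at h
  have h0 : 0 ≤ ∑ k ∈ S, d k ^ (P / (P + 2)) :=
    Finset.sum_nonneg fun k _ => by have := hd k; positivity
  refine (Real.rpow_le_rpow h0 h (by positivity)).trans (le_of_eq ?_)
  rw [← Real.rpow_mul (Finset.sum_nonneg fun k _ => by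
    have := hd k; have := hw k; positivity)]
  congr 1; field_simp

/-- The value reached by the oracle allocation when query `k` has the least cost-weighted variance
`d k`. -/
noncomputable def oracleValue (p : ℝ≥0∞) (d : Fin K → ℝ) : ℝ :=
  (∑ k, d k ^ shareExponent p) ^ (1 / shareExponent p)

/-- Moving the whole share of a query to a judge of cost-weighted variance `d k` can only help, so
only the totals `w k` matter. Hölder then handles finite `p`, and summing `d k ≤ M * w k` handles `p
= ∞`. A query without budget makes the objective infinite. -/
lemma oracleValue_le_allocObjective {p : ℝ≥0∞} (hp : 1 ≤ p) {σ : Fin K → Fin J → ℝ}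
    {c : Fin J → ℝ} {d : Fin K → ℝ} (hd : ∀ k, 0 < d k) (hdle : ∀ k j, d k ≤ c j * σ k j ^ 2)
    {ω : Fin K → Fin J → ℝ} (hω : ω ∈ allocSimplex K J) :
    ENNReal.ofReal (oracleValue p d) ≤ allocObjective p σ c ω := by
  obtain ⟨hω0, hω1⟩ := hω
  set w : Fin K → ℝ := fun k => ∑ j, ω k j with hw
  have hw0 : ∀ k, 0 ≤ w k := fun k => Finset.sum_nonneg fun j _ => hω0 k j
  have hle : ∀ k, ∑ j, ENNReal.ofReal (ω k j / (c j * σ k j ^ 2)) ≤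
      ENNReal.ofReal (w k / d k) := by
    intro k
    rw [← ENNReal.ofReal_sum_of_nonneg fun j _ =>
      div_nonneg (hω0 k j) ((hd k).le.trans (hdle k j)), hw, Finset.sum_div]
    refine ENNReal.ofReal_le_ofReal (Finset.sum_le_sum fun j _ => ?_)
    exact div_le_div_of_nonneg_left (hω0 k j) (hd k) (hdle k j)
  unfold allocObjective
  split_ifs with hpt
  · set M := ⨆ k, (∑ j, ENNReal.ofReal (ω k j / (c j * σ k j ^ 2)))⁻¹ with hM
    by_cases hMt : M = ∞
    · rw [hMt]; exact le_top
    have hk : ∀ k, d k ≤ M.toReal * w k := by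
      intro k
      have h1 : (ENNReal.ofReal (w k / d k))⁻¹ ≤ M :=
        (ENNReal.inv_le_inv.2 (hle k)).trans
          (le_iSup (fun k => (∑ j, ENNReal.ofReal (ω k j / (c j * σ k j ^ 2)))⁻¹) k)
      have hpos : 0 < w k / d k := by
        by_contra hneg
        rw [ENNReal.ofReal_of_nonpos (not_lt.1 hneg), ENNReal.inv_zero, top_le_iff] at h1
        exact hMt h1
      rw [← ENNReal.ofReal_inv_of_pos hpos, ENNReal.ofReal_le_iff_le_toReal hMt, inv_div,
        div_le_iff₀ ((div_pos_iff_of_pos_right (hd k)).1 hpos)] at h1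
      exact h1
    rw [ENNReal.ofReal_le_iff_le_toReal hMt]
    simp only [oracleValue, shareExponent, hpt, if_true, Real.rpow_one, div_one]
    calc _ ≤ ∑ k, M.toReal * w k := Finset.sum_le_sum fun k _ => hk k
      _ = M.toReal := by rw [← Finset.mul_sum, hω1, mul_one]
  · have hP : 0 < p.toReal := ENNReal.toReal_pos (by rintro rfl; simp at hp) hpt
    have hmono : (∑ k, ENNReal.ofReal (w k / d k) ^ (-(p.toReal / 2))) ^ (2 / p.toReal) ≤
        (∑ k, (∑ j, ENNReal.ofReal (ω k j / (c j * σ k j ^ 2))) ^ (-(p.toReal / 2)))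
          ^ (2 / p.toReal) := by
      refine ENNReal.rpow_le_rpow (Finset.sum_le_sum fun k _ => ?_) (by positivity)
      rw [ENNReal.rpow_neg, ENNReal.rpow_neg]
      exact ENNReal.inv_le_inv.2 (ENNReal.rpow_le_rpow (hle k) (by positivity))
    refine le_trans ?_ hmono
    by_cases hall : ∀ k, 0 < w k
    · have e : ∀ k, ENNReal.ofReal (w k / d k) ^ (-(p.toReal / 2)) =
          ENNReal.ofReal ((w k / d k) ^ (-(p.toReal / 2))) := fun k =>
        ENNReal.ofReal_rpow_of_pos (div_pos (hall k) (hd k))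
      simp only [e]
      have hnn : ∀ k, 0 ≤ (w k / d k) ^ (-(p.toReal / 2)) := fun k =>
        Real.rpow_nonneg (div_pos (hall k) (hd k)).le _
      rw [← ENNReal.ofReal_sum_of_nonneg fun k _ => hnn k,
        ENNReal.ofReal_rpow_of_nonneg (Finset.sum_nonneg fun k _ => hnn k) (by positivity)]
      refine ENNReal.ofReal_le_ofReal ?_
      have := rpow_sum_share_le hP Finset.univ hall hd hω1
      simpa only [oracleValue, shareExponent, hpt, if_false, one_div_div] using this
    · push Not at hall
      obtain ⟨k, hk⟩ := hall
      have : ∑ k, ENNReal.ofReal (w k / d k) ^ (-(p.toReal / 2)) = ∞ := by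
        refine ENNReal.sum_eq_top.2 ⟨k, Finset.mem_univ _, ?_⟩
        rw [ENNReal.ofReal_of_nonpos (div_nonpos_of_nonpos_of_nonneg hk (hd k).le)]
        exact ENNReal.zero_rpow_of_neg (by linarith)
      rw [this, ENNReal.top_rpow_of_pos (by positivity)]
      exact le_top

/-- The uniform allocation has finite value. Without this, `toReal` would send an infinite optimum
to `0`. -/
lemma iInf_allocObjective_ne_top (p : ℝ≥0∞) (hK : 1 ≤ K) (hJ : 1 ≤ J)
    {σ : Fin K → Fin J → ℝ} {c : Fin J → ℝ} (hc : ∀ j, 0 < c j) (hσ : ∀ k j, 0 < σ k j) :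
    ⨅ ω ∈ allocSimplex K J, allocObjective p σ c ω ≠ ∞ := by
  have hK' : (1 : ℝ) ≤ K := by exact_mod_cast hK
  have hJ' : (1 : ℝ) ≤ J := by exact_mod_cast hJ
  set ω : Fin K → Fin J → ℝ := fun _ _ => 1 / (K * J) with hω
  have hmem : ω ∈ allocSimplex K J := by
    refine ⟨fun k j => by positivity, ?_⟩
    simp only [hω, Finset.sum_const, Finset.card_univ, Fintype.card_fin, nsmul_eq_mul]
    field_simp
  refine ne_top_of_le_ne_top ?_ (iInf₂_le ω hmem)
  have hpos : ∀ k, ∑ j, ENNReal.ofReal (ω k j / (c j * σ k j ^ 2)) ≠ 0 := by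
    intro k h
    have := (Finset.sum_eq_zero_iff.1 h) ⟨0, hJ⟩ (Finset.mem_univ _)
    rw [ENNReal.ofReal_eq_zero] at this
    have h1 := hc ⟨0, hJ⟩
    have h2 := hσ k ⟨0, hJ⟩
    have : 0 < ω k ⟨0, hJ⟩ / (c ⟨0, hJ⟩ * σ k ⟨0, hJ⟩ ^ 2) := by simp only [hω]; positivity
    linarith
  have hfin : ∀ k, ∑ j, ENNReal.ofReal (ω k j / (c j * σ k j ^ 2)) ≠ ∞ := fun k =>
    ENNReal.sum_ne_top.2 fun j _ => ENNReal.ofReal_ne_top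
  unfold allocObjective
  split_ifs with hpt
  · rw [← lt_top_iff_ne_top, iSup_lt_iff]
    refine ⟨∑ k, (∑ j, ENNReal.ofReal (ω k j / (c j * σ k j ^ 2)))⁻¹, ?_, fun k => ?_⟩
    · exact ENNReal.sum_lt_top.2 fun k _ => (ENNReal.inv_ne_top.2 (hpos k)).lt_top
    · exact Finset.single_le_sum
        (f := fun k => (∑ j, ENNReal.ofReal (ω k j / (c j * σ k j ^ 2)))⁻¹)
        (fun _ _ => zero_le) (Finset.mem_univ k)
  · refine ENNReal.rpow_ne_top_of_nonneg (by positivity) (ENNReal.sum_ne_top.2 fun k _ => ?_)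
    rw [ENNReal.rpow_neg, ENNReal.inv_ne_top, ← pos_iff_ne_zero]
    exact ENNReal.rpow_pos (pos_iff_ne_zero.2 (hpos k)) (hfin k)

lemma oracleValue_le_optValue {p : ℝ≥0∞} (hp : 1 ≤ p) (hK : 1 ≤ K) (hJ : 1 ≤ J)
    {σ : Fin K → Fin J → ℝ} {c : Fin J → ℝ} (hc : ∀ j, 0 < c j) (hσ : ∀ k j, 0 < σ k j)
    {d : Fin K → ℝ} (hd : ∀ k, 0 < d k) (hdle : ∀ k j, d k ≤ c j * σ k j ^ 2) :
    oracleValue p d ≤ optValue p σ c := by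
  refine (ENNReal.ofReal_le_iff_le_toReal (iInf_allocObjective_ne_top p hK hJ hc hσ)).1 ?_
  exact le_iInf₂ fun ω hω => oracleValue_le_allocObjective hp hd hdle hω

/-- With `S = ∑ d k ^ q`, the share `d k ^ q / S` gives variance `S * d k ^ (1 - q)` per unit of
budget, so the vector is that of the oracle standard errors. -/
lemma norm_oracle_le {p : ℝ≥0∞} (hp : 1 ≤ p) {d : Fin K → ℝ} (hd : ∀ k, 0 < d k) :
    ‖WithLp.toLp p fun k => √((∑ k', d k' ^ shareExponent p) * d k ^ (1 - shareExponent p))‖ ≤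
      √(oracleValue p d) := by
  have hS : 0 ≤ ∑ k', d k' ^ shareExponent p :=
    Finset.sum_nonneg fun k _ => Real.rpow_nonneg (hd k).le _
  rcases eq_or_ne p ∞ with rfl | hpt
  · rw [PiLp.norm_toLp, pi_norm_le_iff_of_nonneg (Real.sqrt_nonneg _)]
    intro k
    simp [oracleValue, shareExponent, abs_of_nonneg (Real.sqrt_nonneg _)]
  · have hP : 0 < p.toReal := ENNReal.toReal_pos (by rintro rfl; simp at hp) hpt
    have hq : shareExponent p = p.toReal / (p.toReal + 2) := by simp [shareExponent, hpt]
    rw [PiLp.norm_eq_sum hP]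
    set P := p.toReal with hPdef
    set S := ∑ k', d k' ^ shareExponent p with hSdef
    have e : ∀ k, ‖√(S * d k ^ (1 - shareExponent p))‖ ^ P =
        S ^ (P / 2) * d k ^ shareExponent p := by
      intro k
      have hdk := (hd k).le
      rw [Real.norm_of_nonneg (Real.sqrt_nonneg _), Real.sqrt_eq_rpow,
        ← Real.rpow_mul (by positivity), Real.mul_rpow hS (by positivity),
        ← Real.rpow_mul hdk, hq]
      congr 2
      · ring
      · field_simp; ring
    simp only [e]
    rw [← Finset.mul_sum, ← hSdef, oracleValue, Real.sqrt_eq_rpow, ← hSdef,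
      ← Real.rpow_mul hS, hq]
    rcases hS.eq_or_lt with h0 | h0
    · rw [← h0, mul_zero, Real.zero_rpow (by positivity), Real.zero_rpow (by positivity)]
    · have : S ^ (P / 2) * S = S ^ (P / 2 + 1) := by rw [Real.rpow_add h0, Real.rpow_one]
      rw [this, ← Real.rpow_mul hS]
      refine le_of_eq ?_
      congr 1; field_simp

end Optimum

/-! ### Orders of magnitude of the exploration length and of the losses. -/

section Rates

/-- The exponent of `L / B` in the lower-order term of the error rate. -/
noncomputable def rateExponent (p : ℝ≥0∞) : ℝ :=
  if 2 ≤ p then 2 / 3 else (3 * p.toReal + 2) / (4 * p.toReal + 4)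

lemma half_lt_rateExponent (p : ℝ≥0∞) (hp : 1 ≤ p) : 1 / 2 < rateExponent p := by
  unfold rateExponent
  split_ifs with h
  · norm_num
  · have hP : 0 < p.toReal := ENNReal.toReal_pos (by rintro rfl; simp at hp)
      (by rintro rfl; simp at h)
    rw [lt_div_iff₀ (by positivity)]
    linarith

lemma rateExponent_le (p : ℝ≥0∞) : rateExponent p ≤ 2 / 3 := by
  unfold rateExponent
  split_ifs with h
  · norm_num
  · have h2 : p.toReal ≤ 2 := by
      have := ENNReal.toReal_mono (by norm_num) (not_le.1 h).le
      simpa using this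
    have hP : 0 ≤ p.toReal := ENNReal.toReal_nonneg
    rw [div_le_iff₀ (by positivity)]
    linarith

variable {p : ℝ≥0∞} {K J : ℕ} {R δ B L : ℝ}

/-- The two regimes differ only in the exponent and in a power of `2`, which `γ` absorbs; this lets
the later estimates treat them together. -/
lemma exists_explorationLength_eq (hp : 1 ≤ p) (hR : 0 < R) (hB : 0 < B) (hL : 0 < L)
    (hLdef : L = Real.log (4 * K * J / δ)) :
    ∃ γ : ℝ, 1 ≤ γ ∧ γ ≤ 2 ∧ explorationLength p K J R δ B =
      ⌈γ * (B * (R ^ 2 * L / B) ^ rateExponent p)⌉₊ := by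
  have hform : ∀ a : ℝ, B * (R ^ 2 * L / B) ^ a = R ^ (2 * a) * L ^ a * B ^ (1 - a) := by
    intro a
    rw [Real.div_rpow (by positivity) hB.le, Real.mul_rpow (by positivity) hL.le,
      Real.rpow_sub hB, Real.rpow_one, Real.rpow_mul hR.le, Real.rpow_two]
    ring
  unfold explorationLength rateExponent
  rw [← hLdef]
  split_ifs with h
  · refine ⟨2 ^ (1 / 3 : ℝ), Real.one_le_rpow (by norm_num) (by norm_num), ?_, ?_⟩
    · exact Real.rpow_le_self_of_one_le (by norm_num) (by norm_num)
    · congr 1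
      rw [hform, Real.mul_rpow (by norm_num) hB.le, Real.mul_rpow (by positivity) hL.le,
        Real.rpow_mul hR.le, Real.rpow_two]
      norm_num
      ring
  · have hP : 0 < p.toReal := ENNReal.toReal_pos (by rintro rfl; simp at hp)
      (by rintro rfl; simp at h)
    refine ⟨2 ^ (p.toReal / (2 * p.toReal + 2)), Real.one_le_rpow (by norm_num) (by positivity),
      ?_, ?_⟩
    · refine Real.rpow_le_self_of_one_le (by norm_num) ?_
      rw [div_le_one (by positivity)]; linarith
    · congr 1
      rw [hform, show 2 * ((3 * p.toReal + 2) / (4 * p.toReal + 4)) =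
          (3 * p.toReal + 2) / (2 * p.toReal + 2) by field_simp; ring,
        show 1 - (3 * p.toReal + 2) / (4 * p.toReal + 4) =
          (p.toReal + 2) / (4 * p.toReal + 4) by field_simp; ring]
      ring

lemma lowerOrderTerm_eq (hp : 1 ≤ p) (hR : 0 < R) (hB : 0 < B) (hL : 0 < L)
    (hLdef : L = Real.log (4 * K * J / δ)) (A : ℝ) :
    lowerOrderTerm p K J R δ B A =
      A * (R ^ 2 * L / B) ^ (rateExponent p - 1 / 2) * √(L / B) := by
  have hform : ∀ a : ℝ, A * (R ^ 2 * L / B) ^ (a - 1 / 2) * √(L / B) =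
      R ^ (2 * a - 1) * A * L ^ a / B ^ a := by
    intro a
    have h1 : (R ^ 2 * L / B) ^ (a - 1 / 2) = R ^ (2 * a - 1) * (L / B) ^ (a - 1 / 2) := by
      rw [mul_div_assoc, Real.mul_rpow (by positivity) (by positivity), ← Real.rpow_two,
        ← Real.rpow_mul hR.le]
      congr 2; ring
    have h2 : (L / B) ^ (a - 1 / 2) * √(L / B) = L ^ a / B ^ a := by
      rw [Real.sqrt_eq_rpow, ← Real.rpow_add (by positivity), sub_add_cancel,
        Real.div_rpow hL.le hB.le]
    rw [h1]
    calc _ = R ^ (2 * a - 1) * A * ((L / B) ^ (a - 1 / 2) * √(L / B)) := by ring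
      _ = _ := by rw [h2]; ring
  rw [hform]
  unfold lowerOrderTerm rateExponent
  rw [← hLdef]
  split_ifs with h
  · norm_num
  · have hP : 0 < p.toReal := ENNReal.toReal_pos (by rintro rfl; simp at hp)
      (by rintro rfl; simp at h)
    rw [show 2 * ((3 * p.toReal + 2) / (4 * p.toReal + 4)) - 1 =
          p.toReal / (2 * p.toReal + 2) by field_simp; ring]

/-- In terms of the relative error `θ = (R² L / B) ^ (a - 1/2)`, with `a` the rate exponent: the
bias, the share of the budget spent on exploration, the rounding errors and the range term of
Bernstein's inequality are all of order `θ`. -/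
lemma exists_rate_bounds (hp : 1 ≤ p) {D σ₀ : ℝ} (hD : 0 < D) (hσ₀ : 0 < σ₀) :
    ∃ C : ℝ, 1 ≤ C ∧ ∀ (K J : ℕ) (R δ B L τ : ℝ) (N₀ : ℕ), σ₀ ≤ R → 0 < B → 1 ≤ L →
      L = Real.log (4 * K * J / δ) → N₀ = explorationLength p K J R δ B → 2 ≤ N₀ →
      τ = optimisticBias K J R δ N₀ → 2 * (N₀ : ℝ) * D ≤ B →
      ∃ θ : ℝ, 0 < θ ∧ θ ≤ C ∧ 0 < τ ∧ τ ≤ C * θ ∧ N₀ ≤ C * θ * B ∧ 1 ≤ C * θ * B ∧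
        R * √(L / B) ≤ C * θ ∧
        ∀ A, lowerOrderTerm p K J R δ B A = A * θ * √(L / B) := by
  set M : ℝ := max 1 (1 / (2 * D)) with hM
  have hM1 : 1 ≤ M := le_max_left _ _
  set Q : ℝ := M ^ 2 with hQ
  have hQ1 : 1 ≤ Q := one_le_pow₀ hM1
  have hQσ : 0 < Q / σ₀ ^ 2 := by positivity
  refine ⟨4 * Q + Q / σ₀ ^ 2, by linarith, ?_⟩
  intro K J R δ B L τ N₀ hσR hB hL hLdef hN hN2 hτ hbud
  have hR : 0 < R := hσ₀.trans_le hσR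
  have hL0 : 0 < L := by linarith
  set a := rateExponent p with ha
  have ha1 := half_lt_rateExponent p hp
  have ha2 := rateExponent_le p
  rw [← ha] at ha1 ha2
  set ρ : ℝ := R ^ 2 * L / B with hρ
  have hρ0 : 0 < ρ := by positivity
  have hN2' : (2 : ℝ) ≤ N₀ := by exact_mod_cast hN2
  obtain ⟨γ, hγ1, hγ2, hγ⟩ := exists_explorationLength_eq (p := p) (δ := δ) hp hR hB hL0 hLdef
  rw [← ha, ← hρ] at hγ
  have hBρ : 0 < B * ρ ^ a := by positivity
  have hlow : B * ρ ^ a ≤ N₀ := by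
    rw [hN, hγ]
    refine le_trans ?_ (Nat.le_ceil _)
    nlinarith
  -- The `+ 1` of the ceiling is at most `N₀ / 2`, since `2 ≤ N₀`.
  have hup : (N₀ : ℝ) ≤ 4 * (B * ρ ^ a) := by
    have : (N₀ : ℝ) < γ * (B * ρ ^ a) + 1 := by
      rw [hN, hγ]; exact Nat.ceil_lt_add_one (by positivity)
    nlinarith
  -- The budget condition bounds `N₀ / B`, hence `ρ`, by a constant. Surplus nonnegative powers of
  -- `ρ` can then be discarded.
  have hρa : ρ ^ a ≤ M := by
    refine le_trans ?_ (le_max_right _ _)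
    rw [le_div_iff₀ (by positivity)]
    have : B * (ρ ^ a * (2 * D)) ≤ B * 1 := by nlinarith
    exact le_of_mul_le_mul_left this hB
  have hρQ : ρ ≤ Q := by
    rcases le_total ρ 1 with h1 | h1
    · linarith
    · calc ρ = ρ ^ (1 : ℝ) := (Real.rpow_one ρ).symm
        _ ≤ ρ ^ (a * 2) := Real.rpow_le_rpow_of_exponent_le h1 (by linarith)
        _ = (ρ ^ a) ^ 2 := by rw [Real.rpow_mul hρ0.le, Real.rpow_two]
        _ ≤ M ^ 2 := by gcongr
  have hpow : ∀ e : ℝ, 0 ≤ e → e ≤ 1 → ρ ^ e ≤ Q := by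
    intro e he0 he1
    calc ρ ^ e ≤ Q ^ e := Real.rpow_le_rpow hρ0.le hρQ he0
      _ ≤ Q := Real.rpow_le_self_of_one_le hQ1 he1
  set θ : ℝ := ρ ^ (a - 1 / 2) with hθ
  have hθ0 : 0 < θ := by positivity
  have hsplit : ∀ e : ℝ, ρ ^ e = θ * ρ ^ (e - (a - 1 / 2)) := by
    intro e
    rw [hθ, ← Real.rpow_add hρ0]; congr 1; ring
  have hθQ : θ ≤ Q := hpow _ (by linarith) (by linarith)
  have hCQ : Q ≤ 4 * Q + Q / σ₀ ^ 2 := by linarith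
  have hbias : τ ^ 2 ≤ (2 * Q * θ) ^ 2 := by
    have hN1 : (0 : ℝ) < N₀ - 1 := by linarith
    have e1 : τ ^ 2 = R ^ 2 * (2 / ((N₀ : ℝ) - 1) * L) := by
      rw [hτ, optimisticBias, ← hLdef, mul_pow, Real.sq_sqrt (by positivity)]
    have e2 : R ^ 2 * L = B * ρ := by rw [hρ]; field_simp
    have e3 : ρ = ρ ^ a * ρ ^ (1 - a) := by
      rw [← Real.rpow_add hρ0, add_sub_cancel, Real.rpow_one]
    have e4 : ρ ^ (1 - a) ≤ θ ^ 2 * Q := by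
      -- Since `τ ^ 2` is of order `ρ ^ (1 - a)`, the bias is `O(θ)` because `a ≤ 2 / 3`, with
      -- equality of orders when `a = 2 / 3`.
      have : ρ ^ (1 - a) = θ ^ 2 * ρ ^ (2 - 3 * a) := by
        rw [hθ, ← Real.rpow_natCast, ← Real.rpow_mul hρ0.le, ← Real.rpow_add hρ0]
        congr 1; push_cast; ring
      rw [this]
      gcongr
      exact hpow _ (by linarith) (by linarith)
    have e5 : τ ^ 2 ≤ 4 * ρ ^ (1 - a) := by
      rw [e1, show R ^ 2 * (2 / ((N₀ : ℝ) - 1) * L) = 2 * (R ^ 2 * L) / (N₀ - 1) by ring,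
        div_le_iff₀ hN1, e2]
      have h0 : 0 ≤ ρ ^ (1 - a) := by positivity
      calc 2 * (B * ρ) = 2 * (B * ρ ^ a) * ρ ^ (1 - a) := by
            conv_lhs => rw [e3]
            ring
        _ ≤ 2 * N₀ * ρ ^ (1 - a) := by gcongr
        _ ≤ 2 * (2 * (N₀ - 1)) * ρ ^ (1 - a) := by gcongr; linarith
        _ = _ := by ring
    calc τ ^ 2 ≤ 4 * (θ ^ 2 * Q) := by linarith
      _ ≤ 4 * (θ ^ 2 * (Q * Q)) := by gcongr; nlinarith
      _ = _ := by ring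
  have hτ0 : 0 < τ := by
    have hN1 : (0 : ℝ) < N₀ - 1 := by linarith
    rw [hτ, optimisticBias, ← hLdef]; positivity
  refine ⟨θ, hθ0, hθQ.trans hCQ, hτ0, ?_, ?_, ?_, ?_, ?_⟩
  · refine ((abs_le_of_sq_le_sq' hbias (by positivity)).2).trans ?_
    gcongr; linarith
  · refine hup.trans ?_
    have : ρ ^ a ≤ θ * Q := by
      rw [hsplit a]; gcongr; exact hpow _ (by linarith) (by linarith)
    calc 4 * (B * ρ ^ a) ≤ 4 * (B * (θ * Q)) := by gcongr
      _ = 4 * Q * θ * B := by ring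
      _ ≤ _ := by gcongr; linarith
  -- Rounding changes a count by at most one, which is a relative error `O(θ)` only if `θ * B` is
  -- bounded below. This follows from `σ₀ ≤ R` and `1 ≤ L`.
  · have h1 : σ₀ ^ 2 ≤ B * ρ := by
      have : B * ρ = R ^ 2 * L := by rw [hρ]; field_simp
      rw [this]
      calc σ₀ ^ 2 ≤ R ^ 2 := by gcongr
        _ ≤ R ^ 2 * L := le_mul_of_one_le_right (by positivity) hL
    have h2 : ρ ≤ θ * Q := by
      conv_lhs => rw [← Real.rpow_one ρ, hsplit 1]
      gcongr; exact hpow _ (by linarith) (by linarith)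
    have h3 : 1 ≤ Q / σ₀ ^ 2 * θ * B := by
      rw [div_mul_eq_mul_div, div_mul_eq_mul_div, le_div_iff₀ (by positivity), one_mul]
      calc σ₀ ^ 2 ≤ B * ρ := h1
        _ ≤ B * (θ * Q) := by gcongr
        _ = _ := by ring
    refine h3.trans ?_
    gcongr; linarith
  · have h1 : R * √(L / B) = √ρ := by
      rw [hρ, mul_div_assoc, Real.sqrt_mul (by positivity), Real.sqrt_sq hR.le]
    rw [h1, Real.sqrt_eq_rpow, hsplit, mul_comm]
    gcongr
    exact (hpow _ (by linarith) (by linarith)).trans hCQ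
  · intro A
    exact lowerOrderTerm_eq hp hR hB hL0 hLdef A

set_option maxHeartbeats 1000000 in
/-- The error of the mean of `⌊x⌋₊` scores of variance `g`, where `x` is close to the ideal
number `g * B / W`. -/
lemma exists_mean_error_bound {C₁ W g₀ : ℝ} (hC₁ : 1 ≤ C₁) (hW : 0 < W) (hg₀ : 0 < g₀) :
    ∃ C : ℝ, 0 < C ∧ ∀ θ B b R L l g x e : ℝ, 0 < θ → θ ≤ C₁ → 0 < B → 0 < R → 0 < l → l ≤ L →
      1 ≤ L → B / 2 ≤ b → B ≤ b + C₁ * θ * B → 1 ≤ C₁ * θ * B → R * √(L / B) ≤ C₁ * θ →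
      g₀ ≤ g → b * g ≤ x * (1 + C₁ * θ) ^ 4 * W → e ≤ R →
      (0 < ⌊x⌋₊ → e ≤ (√(2 * (⌊x⌋₊ * g) * l) + R * l) / ⌊x⌋₊) →
      e ≤ √(2 * l / B) * √W + C * (θ * √(L / B)) := by
  set H : ℝ := 1 + C₁ * C₁ with hH
  set κ : ℝ := g₀ / (2 * H ^ 4 * W) with hκ
  have hκ0 : 0 < κ := by positivity
  set C₄ : ℝ := 2 * C₁ + 2 * C₁ / κ with hC₄
  have hC₄0 : 0 < C₄ := by positivity
  set C₅ : ℝ := 3 * C₄ + 3 * C₄ ^ 2 * C₁ + C₄ ^ 3 * C₁ ^ 2 with hC₅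
  refine ⟨2 * C₁ / κ + 2 * C₅ * √W, by positivity, ?_⟩
  intro θ B b R L l g x e hθ hθC hB hR hl hlL hL hb1 hb2 hBθ hRL hg hbg heR he
  set u : ℝ := √(L / B) with hu
  have hu0 : 0 < u := by positivity
  have hu2 : u * u = L / B := Real.mul_self_sqrt (by positivity)
  have hb0 : 0 < b := by linarith
  have hg0 : 0 < g := by linarith
  have hηH : 1 + C₁ * θ ≤ H := by rw [hH]; gcongr
  have hx0 : 0 < x := by
    have : 0 < x * ((1 + C₁ * θ) ^ 4 * W) := by
      rw [← mul_assoc]; exact (mul_pos hb0 hg0).trans_le hbg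
    exact pos_of_mul_pos_left this (by positivity)
  have hxκ : κ * B ≤ x := by
    have : B / 2 * g₀ ≤ x * H ^ 4 * W := by
      calc B / 2 * g₀ ≤ b * g := by gcongr
        _ ≤ x * (1 + C₁ * θ) ^ 4 * W := hbg
        _ ≤ x * H ^ 4 * W := by gcongr
    rw [hκ, div_mul_eq_mul_div, div_le_iff₀ (by positivity)]
    linarith
  have hfirst : 0 ≤ √(2 * l / B) * √W := by positivity
  rcases lt_or_ge (κ * B) 2 with hsmall | hlarge
  · have h1 : R ≤ 2 * C₁ / κ * (θ * u) := by
      have h2 : R * u * u ≤ C₁ * θ * u := by gcongr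
      rw [mul_assoc, hu2] at h2
      have h3 : κ / 2 ≤ L / B := by
        rw [div_le_div_iff₀ (by norm_num) hB]; linarith
      have h4 : R * (κ / 2) ≤ C₁ * θ * u := (mul_le_mul_of_nonneg_left h3 hR.le).trans h2
      rw [div_mul_eq_mul_div, le_div_iff₀ hκ0]
      linarith
    have h5 : 0 ≤ 2 * C₅ * √W * (θ * u) := by positivity
    rw [add_mul]
    linarith
  · have hx2 : 2 ≤ x := hlarge.trans hxκ
    set n : ℕ := ⌊x⌋₊ with hn
    have hn1 : x - 1 < n := Nat.sub_one_lt_floor x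
    have hn0 : (0 : ℝ) < n := by linarith
    have hnx : x / 2 ≤ n := by linarith
    have hnκ : κ * B / 2 ≤ n := by linarith
    refine (he (by exact_mod_cast hn0)).trans ?_
    have hratio : x ≤ n * (1 + C₄ * θ) := by
      have h1 : 1 ≤ n * (2 * C₁ / κ * θ) := by
        calc (1 : ℝ) ≤ C₁ * θ * B := hBθ
          _ = κ * B / 2 * (2 * C₁ / κ * θ) := by field_simp
          _ ≤ _ := by gcongr
      have h2 : 0 ≤ n * (2 * C₁ * θ) := by positivity
      rw [hC₄]; linarith
    have hBb : B ≤ b * (1 + C₄ * θ) := by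
      have h1 : C₁ * θ * B ≤ C₁ * θ * (2 * b) := by gcongr; linarith
      have h2 : 0 ≤ b * (2 * C₁ / κ * θ) := by positivity
      rw [hC₄]; linarith
    have hη4 : 1 + C₁ * θ ≤ 1 + C₄ * θ := by
      have : 0 ≤ 2 * C₁ / κ := by positivity
      gcongr; linarith
    -- Six factors accumulate: four from the estimated allocation, one from rounding and one from
    -- the exploration budget. The square root leaves three.
    have hgn : g / n ≤ W / B * ((1 + C₄ * θ) ^ 3) ^ 2 := by
      rw [div_le_iff₀ hn0, div_mul_eq_mul_div, div_mul_eq_mul_div, le_div_iff₀ hB]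
      calc g * B ≤ g * (b * (1 + C₄ * θ)) := by gcongr
        _ = b * g * (1 + C₄ * θ) := by ring
        _ ≤ x * (1 + C₁ * θ) ^ 4 * W * (1 + C₄ * θ) := by gcongr
        _ ≤ n * (1 + C₄ * θ) * (1 + C₄ * θ) ^ 4 * W * (1 + C₄ * θ) := by gcongr
        _ = _ := by ring
    have hcube : (1 + C₄ * θ) ^ 3 ≤ 1 + C₅ * θ := by
      have h1 : θ ^ 2 ≤ C₁ * θ := by rw [sq]; gcongr
      have h2 : θ ^ 3 ≤ C₁ ^ 2 * θ := by
        calc θ ^ 3 = θ * θ * θ := by ring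
          _ ≤ C₁ * C₁ * θ := by gcongr
          _ = _ := by ring
      have h3 := mul_le_mul_of_nonneg_left h1 (show 0 ≤ 3 * C₄ ^ 2 by positivity)
      have h4 := mul_le_mul_of_nonneg_left h2 (show 0 ≤ C₄ ^ 3 by positivity)
      rw [hC₅]; linarith
    have hsqrt : √(2 * (n * g) * l) / n ≤ √(2 * l / B) * √W * (1 + C₅ * θ) := by
      calc √(2 * (n * g) * l) / n = √(2 * l * (g / n)) := by
            rw [show 2 * l * (g / n) = 2 * (n * g) * l / (n : ℝ) ^ 2 by field_simp,
              Real.sqrt_div (by positivity), Real.sqrt_sq hn0.le]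
        _ ≤ √(2 * l * (W / B * ((1 + C₄ * θ) ^ 3) ^ 2)) := by gcongr
        _ = √(2 * l / B) * √W * (1 + C₄ * θ) ^ 3 := by
            rw [show 2 * l * (W / B * ((1 + C₄ * θ) ^ 3) ^ 2) =
              2 * l / B * W * ((1 + C₄ * θ) ^ 3) ^ 2 by ring, Real.sqrt_mul (by positivity),
              Real.sqrt_mul (by positivity), Real.sqrt_sq (by positivity)]
        _ ≤ _ := by gcongr
    have hlu : √(2 * l / B) ≤ 2 * u := by
      rw [Real.sqrt_le_left (by positivity), mul_pow, sq u, hu2, div_le_iff₀ hB]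
      field_simp; linarith
    have hrange : R * l / n ≤ 2 * C₁ / κ * (θ * u) := by
      calc R * l / n ≤ R * L / (κ * B / 2) := by gcongr
        _ = 2 / κ * (R * (L / B)) := by field_simp
        _ = 2 / κ * (R * u * u) := by rw [← hu2]; ring
        _ ≤ 2 / κ * (C₁ * θ * u) := by gcongr
        _ = _ := by ring
    rw [add_div]
    have h6 : √(2 * l / B) * √W * (C₅ * θ) ≤ 2 * u * √W * (C₅ * θ) := by gcongr
    linarith

end Rates

/-! ### Stability of the allocation and the error of one query. -/

section Algorithm

variable {K J : ℕ}

lemma norm_toLp_mono {p : ℝ≥0∞} (hp : 1 ≤ p) {x y : Fin K → ℝ} (h : ∀ k, |x k| ≤ y k) :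
    ‖WithLp.toLp p x‖ ≤ ‖WithLp.toLp p y‖ := by
  rcases eq_or_ne p ∞ with rfl | hpt
  · rw [PiLp.norm_toLp, PiLp.norm_toLp, pi_norm_le_iff_of_nonneg (norm_nonneg _)]
    intro k
    exact ((h k).trans (le_abs_self _)).trans (norm_le_pi_norm y k)
  · have hP : 0 < p.toReal := ENNReal.toReal_pos (by rintro rfl; simp at hp) hpt
    rw [PiLp.norm_eq_sum hP, PiLp.norm_eq_sum hP]
    refine Real.rpow_le_rpow (Finset.sum_nonneg fun k _ => by positivity)
      (Finset.sum_le_sum fun k _ => ?_) (by positivity)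
    exact Real.rpow_le_rpow (norm_nonneg _) ((h k).trans (le_abs_self _)) hP.le

/-- Stability of the oracle allocation under a multiplicative perturbation of the standard
deviations. -/
lemma cost_mul_var_le_oracleShare (p : ℝ≥0∞) (hp : 1 ≤ p) {sel : (Fin J → ℝ) → Fin J}
    (hsel : ∀ (v : Fin J → ℝ) (j : Fin J), v (sel v) ≤ v j) {c : Fin J → ℝ} (hc : ∀ j, 0 < c j)
    {σ v : Fin K → Fin J → ℝ} (hσ : ∀ k j, 0 < σ k j) (hv : ∀ k j, 0 < v k j) {η : ℝ}
    (hη : 0 < η) (hvσ : ∀ k j, v k j ≤ η * σ k j) (hσv : ∀ k j, σ k j ≤ η * v k j)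
    {d : Fin K → ℝ} (hd : ∀ k, ∃ j, d k = c j * σ k j ^ 2) (k : Fin K) :
    c (chosenJudge sel c v k) * σ k (chosenJudge sel c v k) ^ 2 ≤
      oracleShare p sel v c k (chosenJudge sel c v k) * η ^ 4 *
        ((∑ k', d k' ^ shareExponent p) * d k ^ (1 - shareExponent p)) := by
  have hq0 := shareExponent_pos hp
  have hq1 := shareExponent_le_one p
  set q := shareExponent p with hq
  set e : Fin K → ℝ := fun k => c (chosenJudge sel c v k) * v k (chosenJudge sel c v k) ^ 2 with he
  have he0 : ∀ k, 0 < e k := fun k => mul_pos (hc _) (pow_pos (hv _ _) 2)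
  have hd0 : ∀ k, 0 < d k := fun k => by
    obtain ⟨j, hj⟩ := hd k
    rw [hj]; exact mul_pos (hc _) (pow_pos (hσ _ _) 2)
  -- The chosen judge minimizes the estimated cost, so comparison with the judge attaining `d k`
  -- costs one factor `η ^ 2`. Returning from `v` to `σ` at the chosen judge costs the other.
  have hed : ∀ k, e k ≤ η ^ 2 * d k := by
    intro k
    obtain ⟨j, hj⟩ := hd k
    have h1 := hc j
    have h2 := (hv k j).le
    calc e k ≤ c j * v k j ^ 2 := hsel (fun j => c j * v k j ^ 2) j
      _ ≤ c j * (η * σ k j) ^ 2 := by gcongr; exact hvσ k j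
      _ = η ^ 2 * d k := by rw [hj]; ring
  have hshare : oracleShare p sel v c k (chosenJudge sel c v k) = e k ^ q / ∑ k', e k' ^ q :=
    if_pos rfl
  have hS0 : 0 < ∑ k', e k' ^ q :=
    Finset.sum_pos (fun k _ => Real.rpow_pos_of_pos (he0 k) _) ⟨k, Finset.mem_univ _⟩
  have hS : ∑ k', e k' ^ q ≤ (η ^ 2) ^ q * ∑ k', d k' ^ q := by
    rw [Finset.mul_sum]
    refine Finset.sum_le_sum fun k _ => ?_
    rw [← Real.mul_rpow (by positivity) (hd0 k).le]
    exact Real.rpow_le_rpow (he0 k).le (hed k) hq0.le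
  have he1 : e k ^ (1 - q) ≤ (η ^ 2) ^ (1 - q) * d k ^ (1 - q) := by
    rw [← Real.mul_rpow (by positivity) (hd0 k).le]
    exact Real.rpow_le_rpow (he0 k).le (hed k) (by linarith)
  have hek : e k = e k ^ q * e k ^ (1 - q) := by
    rw [← Real.rpow_add (he0 k), add_sub_cancel, Real.rpow_one]
  have hη2 : (η ^ 2) ^ q * (η ^ 2) ^ (1 - q) = η ^ 2 := by
    rw [← Real.rpow_add (by positivity), add_sub_cancel, Real.rpow_one]
  have hmain : e k ≤ e k ^ q / (∑ k', e k' ^ q) *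
      (η ^ 2 * ((∑ k', d k' ^ q) * d k ^ (1 - q))) := by
    rw [div_mul_eq_mul_div, le_div_iff₀ hS0]
    have h1 : 0 ≤ e k ^ (1 - q) := Real.rpow_nonneg (he0 k).le _
    have h2 : 0 ≤ e k ^ q := Real.rpow_nonneg (he0 k).le _
    calc e k * ∑ k', e k' ^ q = e k ^ q * ((∑ k', e k' ^ q) * e k ^ (1 - q)) := by
          conv_lhs => rw [hek]
          ring
      _ ≤ e k ^ q * (((η ^ 2) ^ q * ∑ k', d k' ^ q) * ((η ^ 2) ^ (1 - q) * d k ^ (1 - q))) := by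
          gcongr
          exact hS0.le.trans hS
      _ = e k ^ q * (((η ^ 2) ^ q * (η ^ 2) ^ (1 - q)) *
          ((∑ k', d k' ^ q) * d k ^ (1 - q))) := by ring
      _ = _ := by rw [hη2]
  rw [hshare]
  have h1 := hc (chosenJudge sel c v k)
  have h2 := (hσ k (chosenJudge sel c v k)).le
  calc c (chosenJudge sel c v k) * σ k (chosenJudge sel c v k) ^ 2
      ≤ c (chosenJudge sel c v k) * (η * v k (chosenJudge sel c v k)) ^ 2 := by
        gcongr; exact hσv _ _
    _ = η ^ 2 * e k := by simp only [he]; ring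
    _ ≤ η ^ 2 * (e k ^ q / (∑ k', e k' ^ q) *
      (η ^ 2 * ((∑ k', d k' ^ q) * d k ^ (1 - q)))) := by gcongr
    _ = _ := by ring

lemma sum_oracleShare_le_one (p : ℝ≥0∞) (sel : (Fin J → ℝ) → Fin J) (c : Fin J → ℝ)
    (v : Fin K → Fin J → ℝ) :
    ∑ k, ∑ j, oracleShare p sel v c k j ≤ 1 := by
  simp only [oracleShare, Finset.sum_ite_eq', Finset.mem_univ, if_true]
  rw [← Finset.sum_div]
  exact div_self_le_one _

lemma oracleShare_nonneg (p : ℝ≥0∞) (sel : (Fin J → ℝ) → Fin J) {c : Fin J → ℝ}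
    (hc : ∀ j, 0 < c j) (v : Fin K → Fin J → ℝ) (k : Fin K) (j : Fin J) :
    0 ≤ oracleShare p sel v c k j := by
  have h : ∀ k : Fin K, 0 ≤ (c (sel fun j => c j * v k j ^ 2) *
      v k (sel fun j => c j * v k j ^ 2) ^ 2) ^ shareExponent p := fun k =>
    Real.rpow_nonneg (mul_nonneg (hc _).le (sq_nonneg _)) _
  unfold oracleShare
  dsimp only
  split_ifs
  · exact div_nonneg (h k) (Finset.sum_nonneg fun k _ => h k)
  · exact le_rfl

lemma estIVWE_cost_le (p : ℝ≥0∞) (sel : (Fin J → ℝ) → Fin J) {c : Fin J → ℝ}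
    (hc : ∀ j, 0 < c j) {B τ : ℝ} {N₀ : ℕ} (hB : 0 ≤ B - N₀ * (K * ∑ j, c j))
    (x : ScoreTable K J) :
    ∑ j, c j * ∑ k, ((estIVWE p sel B c N₀ τ).numQueries x k j : ℝ) ≤ B := by
  set b := B - N₀ * (K * ∑ j, c j) with hb
  have h1 : ∀ k j, c j * (phaseTwoCount p sel B c N₀ τ x k j : ℝ) ≤
      b * oracleShare p sel (optimisticStd N₀ τ x) c k j := by
    intro k j
    have h0 := oracleShare_nonneg p sel hc (optimisticStd N₀ τ x) k j
    have := Nat.floor_le (div_nonneg (mul_nonneg hB h0) (hc j).le)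
    rwa [le_div_iff₀ (hc j), mul_comm] at this
  calc ∑ j, c j * ∑ k, ((estIVWE p sel B c N₀ τ).numQueries x k j : ℝ)
      = N₀ * (K * ∑ j, c j) + ∑ k, ∑ j, c j * (phaseTwoCount p sel B c N₀ τ x k j : ℝ) := by
        rw [Finset.sum_comm (γ := Fin K), ← mul_assoc, Finset.mul_sum, ← Finset.sum_add_distrib]
        refine Finset.sum_congr rfl fun j _ => ?_
        simp only [estIVWE, Nat.cast_add, Finset.sum_add_distrib, Finset.sum_const,
          Finset.card_univ, Fintype.card_fin, nsmul_eq_mul, ← Finset.mul_sum]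
        ring
    _ ≤ N₀ * (K * ∑ j, c j) + ∑ k, ∑ j, b * oracleShare p sel (optimisticStd N₀ τ x) c k j := by
        exact add_le_add_right (Finset.sum_le_sum fun k _ => Finset.sum_le_sum fun j _ => h1 k j) _
    _ ≤ N₀ * (K * ∑ j, c j) + b * 1 := by
        simp only [← Finset.mul_sum]
        gcongr
        exact sum_oracleShare_le_one p sel c _
    _ = B := by rw [hb]; ring

/-- The estimate is the mean of the fresh scores of the chosen judge. -/
lemma estIVWE_estimate_eq (p : ℝ≥0∞) (sel : (Fin J → ℝ) → Fin J) (c : Fin J → ℝ)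
    (B τ : ℝ) (N₀ : ℕ) (hτ : 0 < τ) (x : ScoreTable K J) (k : Fin K) {j : Fin J} {n : ℕ}
    (hj : j = chosenJudge sel c (optimisticStd N₀ τ x) k)
    (hn : n = phaseTwoCount p sel B c N₀ τ x k j) :
    (estIVWE p sel B c N₀ τ).estimate x k = empMean n fun i => x k j (N₀ + i) := by
  have hv : 0 < optimisticStd N₀ τ x k j := add_pos_of_pos_of_nonneg hτ (Real.sqrt_nonneg _)
  have hz : ∀ i, i ≠ j → phaseTwoCount p sel B c N₀ τ x k i = 0 := by
    intro i hi
    have : oracleShare p sel (optimisticStd N₀ τ x) c k i = 0 := if_neg (by rwa [hj] at hi)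
    simp [phaseTwoCount, this]
  simp only [estIVWE, ivwe]
  rw [Finset.sum_eq_single j (fun i _ hi => by rw [hz i hi]; simp) (by simp),
    Finset.sum_eq_single j (fun i _ hi => by rw [hz i hi]; simp) (by simp), ← hn]
  -- Only one judge is called, so its weight cancels; with no calls, both sides are `0` by the
  -- convention for division by zero.
  rcases Nat.eq_zero_or_pos n with h0 | h0
  · simp [h0, empMean]
  · field_simp

lemma empMean_mem_Icc {R : ℝ} (hR : 0 ≤ R) {x : ℕ → ℝ} (hx : ∀ n, x n ∈ Set.Icc 0 R) (n : ℕ) :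
    empMean n x ∈ Set.Icc 0 R := by
  unfold empMean
  refine ⟨div_nonneg (Finset.sum_nonneg fun i _ => (hx i).1) (Nat.cast_nonneg n), ?_⟩
  refine div_le_of_le_mul₀ (Nat.cast_nonneg n) hR ?_
  have := Finset.sum_le_card_nsmul (Finset.range n) x R fun i _ => (hx i).2
  rw [Finset.card_range, nsmul_eq_mul] at this
  linarith

lemma abs_empMean_sub {x : ℕ → ℝ} {n : ℕ} (hn : 0 < n) (m : ℝ) :
    |empMean n x - m| = |∑ i ∈ Finset.range n, (x i - m)| / n := by
  have h0 : (0 : ℝ) < n := by exact_mod_cast hn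
  rw [Finset.sum_sub_distrib, Finset.sum_const, Finset.card_range, nsmul_eq_mul, empMean,
    ← abs_of_pos h0, ← abs_div, abs_of_pos h0]
  congr 1; field_simp

/-- Optimistic standard deviations are correct up to a factor `1 + 240 τ / σ₀`. -/
lemma optimistic_bounds {a σ σ₀ τ : ℝ} (hσ₀ : 0 < σ₀) (hσ : σ₀ ≤ σ) (hτ : 0 < τ) (ha : 0 ≤ a)
    (h : |a - σ| ≤ 16 * τ) :
    τ + a ≤ (1 + 240 * τ / σ₀) * σ ∧ σ ≤ (1 + 240 * τ / σ₀) * (τ + a) := by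
  obtain ⟨h1, h2⟩ := abs_le.1 h
  have e : ∀ y : ℝ, (1 + 240 * τ / σ₀) * y = y + τ * (240 * y / σ₀) := fun y => by ring
  constructor
  · have : 240 ≤ 240 * σ / σ₀ := by rw [le_div_iff₀ hσ₀]; linarith
    rw [e]; nlinarith
  -- Here `240 = 15 * 16`: the gap `σ - (τ + a)` is at most `15 τ`, and `16 * (τ + a) ≥ σ₀` holds
  -- even when `a = 0`.
  · have : 15 ≤ 240 * (τ + a) / σ₀ := by rw [le_div_iff₀ hσ₀]; linarith
    rw [e]; nlinarith

/-- Error of the estimate of one query, on the event where all the scores are well behaved. -/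
lemma exists_query_error_bound {p : ℝ≥0∞} (hp : 1 ≤ p) {c : Fin J → ℝ} (hc : ∀ j, 0 < c j)
    {σ : Fin K → Fin J → ℝ} {σ₀ : ℝ} (hσ₀ : 0 < σ₀) (hσ : ∀ k j, σ₀ ≤ σ k j)
    {d : Fin K → ℝ} (hd : ∀ k, ∃ j, d k = c j * σ k j ^ 2) {C₁ : ℝ} (hC₁ : 1 ≤ C₁) (k : Fin K) :
    ∃ C : ℝ, 0 < C ∧ ∀ (sel : (Fin J → ℝ) → Fin J) (θ B R L l τ m : ℝ) (N₀ : ℕ)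
      (x : ScoreTable K J), (∀ (v : Fin J → ℝ) (j : Fin J), v (sel v) ≤ v j) →
      0 < θ → θ ≤ C₁ → 0 < B → 0 < R → 0 < l → l ≤ L → 1 ≤ L →
      0 < τ → τ ≤ C₁ * θ → N₀ ≤ C₁ * θ * B → 1 ≤ C₁ * θ * B → R * √(L / B) ≤ C₁ * θ →
      2 * (N₀ : ℝ) * (K * ∑ j, c j) ≤ B → m ∈ Set.Icc 0 R →
      (∀ k j, |√(empVar N₀ (x k j)) - σ k j| ≤ 16 * τ) →
      (∀ j n, x k j n ∈ Set.Icc (0 : ℝ) R) →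
      (let j := chosenJudge sel c (optimisticStd N₀ τ x) k
       let n := phaseTwoCount p sel B c N₀ τ x k j
       0 < n → |∑ i ∈ Finset.range n, (x k j (N₀ + i) - m)| ≤
         √(2 * (n * σ k j ^ 2) * l) + R * l) →
      |(estIVWE p sel B c N₀ τ).estimate x k - m| ≤
        √(2 * l / B) *
          √((∑ k', d k' ^ shareExponent p) * d k ^ (1 - shareExponent p)) +
        C * (θ * √(L / B)) := by
  have hσpos : ∀ k j, 0 < σ k j := fun k j => hσ₀.trans_le (hσ k j)
  have hd0 : ∀ k, 0 < d k := fun k => by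
    obtain ⟨j, hj⟩ := hd k
    rw [hj]; exact mul_pos (hc _) (pow_pos (hσpos _ _) 2)
  set D : ℝ := K * ∑ j, c j with hD
  have hD0 : 0 ≤ D := mul_nonneg (Nat.cast_nonneg _) (Finset.sum_nonneg fun j _ => (hc j).le)
  set W : ℝ := (∑ k', d k' ^ shareExponent p) * d k ^ (1 - shareExponent p) with hW
  have hW0 : 0 < W := mul_pos
    (Finset.sum_pos (fun k _ => Real.rpow_pos_of_pos (hd0 k) _) ⟨k, Finset.mem_univ _⟩)
    (Real.rpow_pos_of_pos (hd0 k) _)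
  -- One constant dominates the given rates, the distortion of the standard deviations (`240 / σ₀`)
  -- and the cost of exploration (`D`).
  set C₂ : ℝ := C₁ * (1 + 240 / σ₀ + D) with hC₂
  have h240 : 0 < 240 / σ₀ := by positivity
  have hC₁₂ : C₁ ≤ C₂ := le_mul_of_one_le_right (by linarith) (by linarith)
  obtain ⟨C, hC0, hC⟩ := exists_mean_error_bound (C₁ := C₂) (W := W) (g₀ := σ₀ ^ 2)
    (hC₁.trans hC₁₂) hW0 (by positivity)
  refine ⟨C, hC0, ?_⟩
  intro sel θ B R L l τ m N₀ x hsel hθ hθC hB hR hl hlL hL hτ hτθ hNθ hBθ hRL hbud hm hvar hx hdev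
  set v := optimisticStd N₀ τ x with hv
  set j := chosenJudge sel c v k with hj
  set n := phaseTwoCount p sel B c N₀ τ x k j with hn
  dsimp only at hdev
  have hmono : C₁ * θ ≤ C₂ * θ := by gcongr
  have hv0 : ∀ k j, 0 < v k j := fun k j => add_pos_of_pos_of_nonneg hτ (Real.sqrt_nonneg _)
  have hη : 1 + 240 * τ / σ₀ ≤ 1 + C₂ * θ := by
    have h1 : 240 * τ / σ₀ ≤ 240 / σ₀ * (C₁ * θ) := by
      rw [mul_div_right_comm]; gcongr
    have h2 : 0 ≤ C₁ * θ * (1 + D) := by positivity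
    rw [hC₂]; linarith
  have hη0 : 0 < 1 + C₂ * θ := by positivity
  have hb := fun k j => optimistic_bounds hσ₀ (hσ k j) hτ (Real.sqrt_nonneg _) (hvar k j)
  have hshare := cost_mul_var_le_oracleShare p hp hsel hc hσpos hv0 hη0
    (fun k j => (hb k j).1.trans (mul_le_mul_of_nonneg_right hη (hσpos k j).le))
    (fun k j => (hb k j).2.trans (mul_le_mul_of_nonneg_right hη (hv0 k j).le)) hd k
  rw [← hj, ← hW] at hshare
  have hest := estIVWE_estimate_eq p sel c B τ N₀ hτ x k hj hn
  rw [hest]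
  have hmean := empMean_mem_Icc hR.le (fun i => hx j (N₀ + i)) n
  have hBpos : 0 ≤ θ * B := by positivity
  refine hC θ B (B - N₀ * D) R L l (σ k j ^ 2) ((B - N₀ * D) * oracleShare p sel v c k j / c j)
    _ hθ (hθC.trans hC₁₂) hB hR hl hlL hL (by linarith) ?_ ?_ (hRL.trans hmono) ?_ ?_ ?_ ?_
  · have h1 : N₀ * D ≤ C₁ * θ * B * D := by gcongr
    have h2 : 0 ≤ C₁ * θ * B * (1 + 240 / σ₀) := by positivity
    rw [hC₂]; linarith
  · exact hBθ.trans (by gcongr)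
  · have := hσ k j
    gcongr
  · rw [div_mul_eq_mul_div, div_mul_eq_mul_div, le_div_iff₀ (hc j)]
    have hb0 : 0 ≤ B - N₀ * D := by linarith
    calc (B - N₀ * D) * σ k j ^ 2 * c j = (B - N₀ * D) * (c j * σ k j ^ 2) := by ring
      _ ≤ (B - N₀ * D) * (oracleShare p sel v c k j * (1 + C₂ * θ) ^ 4 * W) := by gcongr
      _ = _ := by ring
  · rw [abs_le]
    constructor <;> linarith [hmean.1, hmean.2, hm.1, hm.2]
  · intro hn0
    rw [abs_empMean_sub (show 0 < n from hn0)]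
    exact div_le_div_of_nonneg_right (hdev hn0) (Nat.cast_nonneg _)

end Algorithm

end JudgeBudget

/-! ### Assembly of the error bound. -/

theorem theorem4p1 (p : ℝ≥0∞) (hp : 1 ≤ p) (K J : ℕ) (hK : 1 ≤ K) (hJ : 1 ≤ J)
    (c : Fin J → ℝ) (hc : ∀ j, 0 < c j)
    (σ : Fin K → Fin J → ℝ) (hσ : ∀ k j, 0 < σ k j) :
    -- the constant of the `𝒪(·)` depends on nothing that is quantified after it
    ∃ C : ℝ, 0 < C ∧
      ∀ (R : ℝ) (_ : 0 < R) (δ : ℝ) (_ : δ ∈ Set.Ioo (0 : ℝ) 1) (B : ℝ) (_ : 0 < B)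
        (s : Fin K → ℝ)
        (Ω : Type*) [MeasurableSpace Ω] (μ : Measure Ω) [IsProbabilityMeasure μ]
        (X : Fin K → Fin J → ℕ → Ω → ℝ) (_ : JudgeBudget.IsScoreModel μ R s σ X)
        (sel : (Fin J → ℝ) → Fin J) (_ : Measurable sel) (_ : ∀ (v : Fin J → ℝ) (j : Fin J), v (sel v) ≤ v j)
        (N₀ : ℕ) (_ : N₀ = JudgeBudget.explorationLength p K J R δ B) (_ : 2 ≤ N₀)
        (τ : ℝ) (_ : τ = JudgeBudget.optimisticBias K J R δ N₀)
        (_ : 2 * (N₀ : ℝ) * (K * ∑ j, c j) ≤ B),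
        JudgeBudget.BudgetEfficient (JudgeBudget.estIVWE p sel B c N₀ τ) p B δ
          (√(2 * JudgeBudget.optValue p σ c * Real.log (4 * K / δ) / B)
            + C * JudgeBudget.lowerOrderTerm p K J R δ B (JudgeBudget.optValue p σ c))
          s c μ X := by
  have : Nonempty (Fin J) := ⟨⟨0, hJ⟩⟩
  have : Nonempty (Fin K) := ⟨⟨0, hK⟩⟩
  have : Fact (1 ≤ p) := ⟨hp⟩
  obtain ⟨⟨k₀, j₀⟩, hmin⟩ := Finite.exists_min fun q : Fin K × Fin J => σ q.1 q.2
  set σ₀ := σ k₀ j₀ with hσ₀def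
  have hσ₀ : 0 < σ₀ := hσ k₀ j₀
  have hσle : ∀ k j, σ₀ ≤ σ k j := fun k j => hmin (k, j)
  have hdex : ∀ k, ∃ j, ∀ j', c j * σ k j ^ 2 ≤ c j' * σ k j' ^ 2 := fun k =>
    Finite.exists_min fun j => c j * σ k j ^ 2
  choose jOpt hjOpt using hdex
  set d : Fin K → ℝ := fun k => c (jOpt k) * σ k (jOpt k) ^ 2 with hd
  have hd0 : ∀ k, 0 < d k := fun k => mul_pos (hc _) (pow_pos (hσ _ _) 2)
  have hK' : (1 : ℝ) ≤ K := by exact_mod_cast hK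
  have hJ' : (1 : ℝ) ≤ J := by exact_mod_cast hJ
  have hD : 0 < K * ∑ j, c j :=
    mul_pos (by linarith) (Finset.sum_pos (fun j _ => hc j) Finset.univ_nonempty)
  obtain ⟨C₁, hC₁, hrate⟩ := JudgeBudget.exists_rate_bounds hp hD hσ₀
  choose Cq hCq0 hCq using fun k => JudgeBudget.exists_query_error_bound hp hc hσ₀ hσle
    (d := d) (fun k => ⟨jOpt k, rfl⟩) hC₁ k
  set V := JudgeBudget.oracleValue p d with hV
  have hV0 : 0 < V := Real.rpow_pos_of_pos
    (Finset.sum_pos (fun k _ => Real.rpow_pos_of_pos (hd0 k) _) Finset.univ_nonempty) _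
  set A := JudgeBudget.optValue p σ c with hA
  have hVA : V ≤ A := JudgeBudget.oracleValue_le_optValue hp hK hJ hc hσ hd0 hjOpt
  have hA0 : 0 < A := hV0.trans_le hVA
  set C₂ : ℝ := ∑ k, Cq k with hC₂
  have hC₂0 : 0 < C₂ := Finset.sum_pos (fun k _ => hCq0 k) Finset.univ_nonempty
  have hCle : ∀ k, Cq k ≤ C₂ := fun k =>
    Finset.single_le_sum (f := Cq) (fun k _ => (hCq0 k).le) (Finset.mem_univ k)
  set T : ℝ := ‖WithLp.toLp p (fun _ : Fin K => (1 : ℝ))‖ with hT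
  have hT0 : 0 ≤ T := norm_nonneg _
  -- `T` is the norm of the all-ones vector, which carries the uniform remainder. Dividing by `A`
  -- offsets the factor `A` in the lower-order term, and `+ 1` ensures positivity.
  refine ⟨C₂ * T / A + 1, by positivity, ?_⟩
  intro R hR δ hδ B hB s Ω _ μ _ X hX sel hselm hsel N₀ hN₀ hN₀2 τ hτ hbud
  obtain ⟨hδ0, hδ1⟩ := hδ
  set L := Real.log (4 * K * J / δ) with hL
  set l := Real.log (4 * K / δ) with hl
  have h4 : 4 ≤ 4 * K / δ := by rw [le_div_iff₀ hδ0]; nlinarith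
  have hl1 : 1 ≤ l := by
    rw [hl, Real.le_log_iff_exp_le (by linarith)]
    linarith [Real.exp_one_lt_d9]
  have hlL : l ≤ L := by
    refine Real.log_le_log (by linarith) ?_
    exact div_le_div_of_nonneg_right (le_mul_of_one_le_right (by linarith) hJ') hδ0.le
  have hL1 : 1 ≤ L := hl1.trans hlL
  -- Scores in `[0, R]` have variance at most `R ^ 2`, so a score model can exist only when the
  -- range is at least `σ₀`. This is why the constant need not depend on `R`.
  have hσR : σ₀ ≤ R :=
    (abs_le_of_sq_le_sq' (hX.sample k₀ j₀ 0).var_le hR.le).2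
  obtain ⟨θ, hθ0, hθC, hτ0, hτθ, hNθ, hBθ, hRθ, hlow⟩ :=
    hrate K J R δ B L τ N₀ hσR hB hL1 hL hN₀ hN₀2 hτ hbud
  rw [hlow]
  set u := √(L / B) with hu
  have hu0 : 0 < u := by positivity
  set ε := √(2 * A * l / B) + (C₂ * T / A + 1) * (A * θ * u) with hε
  refine ⟨by positivity, ?_, Filter.Eventually.of_forall fun ω =>
    JudgeBudget.estIVWE_cost_le p sel hc (by linarith) _⟩
  set b := B - N₀ * (K * ∑ j, c j) with hb
  have hgood := hX.good_event hR hσ hK hJ hN₀2 ⟨hδ0, hδ1⟩ hτ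
    (G := fun k v => (JudgeBudget.chosenJudge sel c v k,
      JudgeBudget.freshCount p sel b c v k (JudgeBudget.chosenJudge sel c v k)))
    (fun k => (JudgeBudget.measurable_chosenJudge hselm c k).prodMk
      (JudgeBudget.measurable_comp_index (JudgeBudget.measurable_chosenJudge hselm c k)
        fun j => JudgeBudget.measurable_freshCount p hselm b c k j))
  refine hgood.trans (MeasureTheory.measureReal_mono ?_)
  rintro ω ⟨hω1, hω2, hω3⟩
  have herr : ∀ k, |(JudgeBudget.estIVWE p sel B c N₀ τ).estimate
      (fun k j n => X k j n ω) k - s k| ≤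
      √(2 * l / B) * √((∑ k', d k' ^ JudgeBudget.shareExponent p) *
        d k ^ (1 - JudgeBudget.shareExponent p)) + C₂ * (θ * u) := by
    intro k
    refine (hCq k sel θ B R L l τ (s k) N₀ (fun k j n => X k j n ω) hsel hθ0 hθC hB hR
      (by linarith) hlL hL1 hτ0 hτθ hNθ hBθ hRθ hbud (hX.sample k j₀ 0).mean_mem hω1
      (fun j n => hω3 k j n) (hω2 k)).trans ?_
    have := hCle k
    gcongr
  refine (JudgeBudget.norm_toLp_mono hp herr).trans ?_
  have hsplit : WithLp.toLp p (fun k => √(2 * l / B) *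
      √((∑ k', d k' ^ JudgeBudget.shareExponent p) * d k ^ (1 - JudgeBudget.shareExponent p)) +
        C₂ * (θ * u)) = √(2 * l / B) • WithLp.toLp p (fun k =>
      √((∑ k', d k' ^ JudgeBudget.shareExponent p) * d k ^ (1 - JudgeBudget.shareExponent p))) +
        (C₂ * (θ * u)) • WithLp.toLp p (fun _ : Fin K => (1 : ℝ)) := by
    ext k
    simp
  rw [hsplit]
  refine (norm_add_le _ _).trans ?_
  rw [norm_smul, norm_smul, Real.norm_of_nonneg (Real.sqrt_nonneg _),
    Real.norm_of_nonneg (by positivity), ← hT, hε]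
  refine add_le_add ?_ ?_
  · calc _ ≤ √(2 * l / B) * √V :=
          mul_le_mul_of_nonneg_left (JudgeBudget.norm_oracle_le hp hd0) (Real.sqrt_nonneg _)
      _ = √(2 * l / B * V) := (Real.sqrt_mul (by positivity) _).symm
      _ ≤ √(2 * l / B * A) := by gcongr
      _ = √(2 * A * l / B) := by congr 1; ring
  · calc C₂ * (θ * u) * T = C₂ * T / A * (A * θ * u) := by field_simp
      _ ≤ _ := by gcongr; linarith
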